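/- **Setting.** We work in many-sorted continuous first-order logic. Structures are complete metric structures with nonempty bounded sorts; symbols have prescribed moduli of uniform continuity. Formulas have finitely many free variables, and every continuous $F:\mathbb R^\omega\to\mathbb R$ is a connective. A theory $T$ is a set of conditions $\varphi\le 0$ ($\varphi$ a sentence). Let $\mathcal L$ be a countable language and $T$ an $\mathcal L$-theory. A set $\Delta$ of formulas is a *distortion system for $T$* if it is logically complete (types of $T$ are determined by the values of the formulas of $\Delta$) and closed under renaming variables, quantification, $1$-Lipschitz connectives, logical equivalence modulo $T$, and uniform limits. A *correlation* between $\mathfrak M$ and $\mathfrak N$ is a relation $R$ between elements of the same sort that is total and surjective in each sort; an *almost correlation* is a correlation between dense sub-pre-structures of $\mathfrak M$ and $\mathfrak N$. Put $$\mathrm{dis}_\Delta(R)=\sup\{|\varphi^{\mathfrak M}(\bar a)-\varphi^{\mathfrak N}(\bar b)|:\varphi\in\Delta,\ (\bar a,\bar b)\in R\}\in[0,\infty].$$ For finite tuples $\bar m\in\mathfrak M$, $\bar n\in\mathfrak N$ of the same length and sorts, $\rho_\Delta(\mathfrak M,\bar m;\mathfrak N,\bar n)$ (resp. $a_\Delta$)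 is the infimum of $\mathrm{dis}_\Delta(R)$ over correlations (resp. almost correlations) $R$ with $(\bar m,\bar n)\in R$. $\Delta$ is *u.u.c.* if for every $\varepsilon>0$ there is $\delta>0$ such that for all $\mathfrak M,\mathfrak N\models T$ and all almost correlations $R$ between them, $\mathrm{dis}_\Delta(R^{<\delta})\le\mathrm{dis}_\Delta(R)+\varepsilon$, where $R^{<\delta}=\{(a,b):\exists (c,d)\in R,\ d(a,c)<\delta,\ d(b,d)<\delta\}$. $\Delta$ is *functional* if for some $\varepsilon>0$, every closed almost correlation $R$ between models of $T$ with $\mathrm{dis}_\Delta(R)<\varepsilon$ is the graph of a uniformly continuous bijection with uniformly continuous inverse. A *weak modulus* is a function $\Omega:[0,\infty)^{\mathbb N}\to[0,\infty]$ that is nondecreasing, subadditive, vanishes at $0$, is lower semicontinuous for the product topology, and is continuous in each argument separately. It is *shift increasing* if $\Omega(\delta_{i_0},\delta_{i_1},\dots)\le\Omega(\delta_0,\delta_1,\dots)$ for all $\delta$ and all $i_0<i_1<\cdots$. A formula $\varphi(x_j,\dots,x_{j+k-1})$ *respects* $\Omega$ in $\mathfrak K$ if $|\varphi^{\mathfrak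 K}(\bar a)-\varphi^{\mathfrak K}(\bar b)|\le\Omega(0,\dots,0,d(a_0,b_0),\dots,d(a_{k-1},b_{k-1}),0,\dots)$, with $j$ leading zeros, for all $\bar a,\bar b\in\mathfrak K$. It is an *$\Omega$-formula* if it respects $\Omega$ in every model of $T$. The back-and-forth pseudo-metrics $r_\alpha=r^{\Delta,\Omega}_\alpha$ are defined by recursion: $r_0(\mathfrak M,\bar m;\mathfrak N,\bar n)$ is the supremum of $|\psi^{\mathfrak M}(\bar m)-\psi^{\mathfrak N}(\bar n)|$ over those $\psi(x_0,\dots,x_{k-1})\in\Delta$ ($k=|\bar m|$) that respect $\Omega$ in every $\mathcal L$-structure; $r_{\alpha+1}(\mathfrak M,\bar m;\mathfrak N,\bar n)$ is the maximum of $\sup_{a\in\mathfrak M}\inf_{b\in\mathfrak N}r_\alpha(\mathfrak M,\bar ma;\mathfrak N,\bar nb)$ and $\sup_{b\in\mathfrak N}\inf_{a\in\mathfrak M}r_\alpha(\mathfrak M,\bar ma;\mathfrak N,\bar nb)$ ($a,b$ of the same sort); $r_\lambda=\sup_{\alpha<\lambda}r_\alpha$ for $\lambda$ a limit ordinal or $\infty$.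 **Statement.** Let $\Delta$ be a distortion system for $T$, a theory in a countable language, and let $\Omega$ be a weak modulus. (i) For all models $\mathfrak M,\mathfrak N$ of $T$ and tuples $\bar m,\bar n$, $r^{\Delta,\Omega}_\infty(\mathfrak M,\bar m;\mathfrak N,\bar n)\le a_\Delta(\mathfrak M,\bar m;\mathfrak N,\bar n)$. Moreover $r^{\Delta,\Omega}_\infty$ is $2$-Lipschitz in $\rho_\Delta$: for models $\mathfrak M,\mathfrak N,\mathfrak M',\mathfrak N'$ of $T$ and tuples of the same length and sorts, $$r^{\Delta,\Omega}_\infty(\mathfrak M,\bar m;\mathfrak N,\bar n)\le r^{\Delta,\Omega}_\infty(\mathfrak M',\bar m';\mathfrak N',\bar n')+2\max\{\rho_\Delta(\mathfrak M,\bar m;\mathfrak M',\bar m'),\rho_\Delta(\mathfrak N,\bar n;\mathfrak N',\bar n')\}.$$ (ii) If $\Delta$ is u.u.c. and $\Omega$ is shift increasing and such that $\varphi(x_0,x_1,\dots)$ is an $\Omega$-formula for every $\varphi\in\Delta$, then $r^{\Delta,\Omega}_\infty(\mathfrak M,\bar m;\mathfrak N,\bar n)=\rho_\Delta(\mathfrak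 M,\bar m;\mathfrak N,\bar n)$ for all separable models $\mathfrak M,\mathfrak N$ of $T$ and all tuples $\bar m,\bar n$. (iii) If $\Delta$ is functional, then for every sequence $(\varphi_i)_{i<\omega}$ in $\Delta$ that is dense in $\Delta$ for the uniform norm over models of $T$ (up to injectively renaming variables and adding dummy variables), and if $\Omega$ is shift increasing and such that for every $i$ there is $n$ such that $\varphi_i(x_n,x_{n+1},\dots,x_{n+k-1})$ is an $\Omega$-formula ($k$ the number of variables of $\varphi_i$), there is $\varepsilon>0$ such that for all separable models $\mathfrak M,\mathfrak N$ of $T$, if $r^{\Delta,\Omega}_\infty(\mathfrak M,\mathfrak N)<\varepsilon$, then $r^{\Delta,\Omega}_\infty(\mathfrak M,\mathfrak N)=\rho_\Delta(\mathfrak M,\mathfrak N)$. -/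

import Mathlib

open scoped ENNReal NNReal

universe u v

noncomputable section

namespace MetricLogic

/-! ### Many-sorted continuous first-order logic -/

/-- A many-sorted language of continuous logic: sorts with bounds on their diameters, function
symbols with moduli of uniform continuity, and predicate symbols with moduli of uniform continuity
and closed bounded intervals of values. -/
structure Lang where
  Sorts : Type u
  diam : Sorts → ℝ
  Fn : Type u
  fnArity : Fn → ℕ
  fnDom : ∀ f : Fn, Fin (fnArity f) → Sorts
  fnCod : Fn → Sorts
  fnMod : Fn → ℝ → ℝ
  fnMod_pos : ∀ f ε, 0 < ε → 0 < fnMod f ε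
  Pred : Type u
  predArity : Pred → ℕ
  predDom : ∀ P : Pred, Fin (predArity P) → Sorts
  predLo : Pred → ℝ
  predHi : Pred → ℝ
  predMod : Pred → ℝ → ℝ
  predMod_pos : ∀ P ε, 0 < ε → 0 < predMod P ε

/-- The language has countably many sorts, function symbols and predicate symbols. -/
def Lang.IsCountable (L : Lang.{u}) : Prop :=
  Countable L.Sorts ∧ Countable L.Fn ∧ Countable L.Pred

/-- A metric structure: each sort is a nonempty complete metric space; function and predicate
symbols are interpreted respecting the data of the language. -/
structure Str (L : Lang.{u}) where
  carrier : L.Sorts → Type v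
  metric : ∀ s, MetricSpace (carrier s)
  complete : ∀ s, CompleteSpace (carrier s)
  nonempty : ∀ s, Nonempty (carrier s)
  dist_le : ∀ s (a b : carrier s), dist a b ≤ L.diam s
  fn : ∀ f : L.Fn, (∀ i, carrier (L.fnDom f i)) → carrier (L.fnCod f)
  fn_unif : ∀ (f : L.Fn) (ε : ℝ), 0 < ε → ∀ a b : ∀ i, carrier (L.fnDom f i),
    (∀ i, dist (a i) (b i) < L.fnMod f ε) → dist (fn f a) (fn f b) ≤ ε
  pred : ∀ P : L.Pred, (∀ i, carrier (L.predDom P i)) → ℝ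
  pred_mem : ∀ (P : L.Pred) a, pred P a ∈ Set.Icc (L.predLo P) (L.predHi P)
  pred_unif : ∀ (P : L.Pred) (ε : ℝ), 0 < ε → ∀ a b : ∀ i, carrier (L.predDom P i),
    (∀ i, dist (a i) (b i) < L.predMod P ε) → |pred P a - pred P b| ≤ ε

attribute [instance] Str.metric Str.complete Str.nonempty

/-- A structure is separable if every sort is. -/
def Str.IsSeparable {L : Lang.{u}} (M : Str.{u, v} L) : Prop :=
  ∀ s, TopologicalSpace.SeparableSpace (M.carrier s)

/-- The context `Γ` (a finite list of sorts) with a further sort put in front. -/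
abbrev consCtx {S : Type u} {n : ℕ} (s : S) (Γ : Fin n → S) : Fin (n + 1) → S :=
  Fin.cons (α := fun _ => S) s Γ

/-- Terms in a context: the variable `i` has sort `Γ i`. -/
inductive Term (L : Lang.{u}) {n : ℕ} (Γ : Fin n → L.Sorts) : L.Sorts → Type u
  | var (i : Fin n) : Term L Γ (Γ i)
  | app (f : L.Fn) (t : ∀ i, Term L Γ (L.fnDom f i)) : Term L Γ (L.fnCod f)

/-- First-order formulas with free variables among those of a (finite) context. Every continuous
function `ℝ^ω → ℝ` is a connective; `const` provides the nullary ones. A quantifier binds the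
first variable. -/
inductive Formula (L : Lang.{u}) : {n : ℕ} → (Fin n → L.Sorts) → Type u
  | const {n : ℕ} {Γ : Fin n → L.Sorts} (r : ℝ) : Formula L Γ
  | dist {n : ℕ} {Γ : Fin n → L.Sorts} {s : L.Sorts} (t₁ t₂ : Term L Γ s) : Formula L Γ
  | pred {n : ℕ} {Γ : Fin n → L.Sorts} (P : L.Pred) (t : ∀ i, Term L Γ (L.predDom P i)) :
      Formula L Γ
  | conn {n : ℕ} {Γ : Fin n → L.Sorts} (F : (ℕ → ℝ) → ℝ) (hF : Continuous F)
      (φ : ℕ → Formula L Γ) : Formula L Γ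
  | sup {n : ℕ} {Γ : Fin n → L.Sorts} {s : L.Sorts} (φ : Formula L (consCtx s Γ)) : Formula L Γ
  | inf {n : ℕ} {Γ : Fin n → L.Sorts} {s : L.Sorts} (φ : Formula L (consCtx s Γ)) : Formula L Γ

/-- Value of a term. -/
def Term.eval {L : Lang.{u}} (M : Str.{u, v} L) {n : ℕ} {Γ : Fin n → L.Sorts}
    (a : ∀ i, M.carrier (Γ i)) : {s : L.Sorts} → Term L Γ s → M.carrier s
  | _, .var i => a i
  | _, .app f t => M.fn f fun i => (t i).eval M a

/-- Value `φ^M(a)` of a formula. (All suprema and infima are over nonempty bounded sets.) -/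
def Formula.eval {L : Lang.{u}} (M : Str.{u, v} L) : {n : ℕ} → {Γ : Fin n → L.Sorts} →
    Formula L Γ → (∀ i, M.carrier (Γ i)) → ℝ
  | _, _, .const r, _ => r
  | _, _, .dist t₁ t₂, a => Dist.dist (t₁.eval M a) (t₂.eval M a)
  | _, _, .pred P t, a => M.pred P fun i => (t i).eval M a
  | _, _, .conn F _ φ, a => F fun j => (φ j).eval M a
  | _, Γ, .sup (s := s) φ, a =>
      ⨆ x : M.carrier s, φ.eval M (Fin.cons (α := fun i => M.carrier (consCtx s Γ i)) x a)
  | _, Γ, .inf (s := s) φ, a =>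
      ⨅ x : M.carrier s, φ.eval M (Fin.cons (α := fun i => M.carrier (consCtx s Γ i)) x a)

/-- Replace each variable `i` of `Γ` by the variable `f i` of `Γ'`, which has the same sort. -/
def Term.rename {L : Lang.{u}} {n m : ℕ} {Γ : Fin n → L.Sorts} {Γ' : Fin m → L.Sorts}
    (f : Fin n → Fin m) (h : ∀ i, Γ' (f i) = Γ i) : {s : L.Sorts} → Term L Γ s → Term L Γ' s
  | _, .var i => h i ▸ Term.var (f i)
  | _, .app g t => .app g fun i => (t i).rename f h

/-- The renaming `f`, extended by fixing a new first variable. -/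
def liftRen {n m : ℕ} (f : Fin n → Fin m) : Fin (n + 1) → Fin (m + 1) :=
  Fin.cons (α := fun _ => Fin (m + 1)) 0 fun i => (f i).succ

theorem liftRen_sort {S : Type u} {n m : ℕ} {Γ : Fin n → S} {Γ' : Fin m → S}
    (f : Fin n → Fin m) (h : ∀ i, Γ' (f i) = Γ i) (s : S) :
    ∀ i, consCtx s Γ' (liftRen f i) = consCtx s Γ i :=
  Fin.cases rfl h

/-- Renaming of free variables in a formula; `f` need be neither injective nor surjective. -/
def Formula.rename {L : Lang.{u}} : {n m : ℕ} → {Γ : Fin n → L.Sorts} → {Γ' : Fin m → L.Sorts} →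
    (f : Fin n → Fin m) → (∀ i, Γ' (f i) = Γ i) → Formula L Γ → Formula L Γ'
  | _, _, _, _, _, _, .const r => .const r
  | _, _, _, _, f, h, .dist t₁ t₂ => .dist (t₁.rename f h) (t₂.rename f h)
  | _, _, _, _, f, h, .pred P t => .pred P fun i => (t i).rename f h
  | _, _, _, _, f, h, .conn F hF φ => .conn F hF fun j => (φ j).rename f h
  | _, _, _, _, f, h, .sup (s := s) φ => .sup (φ.rename (liftRen f) (liftRen_sort f h s))
  | _, _, _, _, f, h, .inf (s := s) φ => .inf (φ.rename (liftRen f) (liftRen_sort f h s))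

/-- The empty context. -/
abbrev emptyCtx (L : Lang.{u}) : Fin 0 → L.Sorts := Fin.elim0

/-- A theory is a set of sentences `φ`, each standing for the condition `φ ≤ 0`. -/
abbrev Theory (L : Lang.{u}) := Set (Formula L (emptyCtx L))

def Str.Models {L : Lang.{u}} (M : Str.{u, v} L) (T : Theory L) : Prop :=
  ∀ φ ∈ T, φ.eval M (fun i => i.elim0) ≤ 0

/-! ### Correlations and distortion -/

/-- The sort-by-sort product of two structures. -/
abbrev SProd {L : Lang.{u}} (M N : Str.{u, v} L) := Σ s : L.Sorts, M.carrier s × N.carrier s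

/-- Two tuples of the same length and sorts, as one tuple in the sort-by-sort product. -/
def pairs {L : Lang.{u}} {M N : Str.{u, v} L} {k : ℕ} {Γ : Fin k → L.Sorts}
    (m : ∀ i, M.carrier (Γ i)) (n : ∀ i, N.carrier (Γ i)) : Fin k → SProd M N :=
  fun i => ⟨Γ i, m i, n i⟩

/-- `|φ^M(m) - φ^N(n)|`, where `p` is the pair of tuples `(m, n)`. -/
def gap {L : Lang.{u}} {M N : Str.{u, v} L} {k : ℕ} (p : Fin k → SProd M N)
    (φ : Formula L fun i => (p i).1) : ℝ≥0∞ :=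
  ENNReal.ofReal |φ.eval M (fun i => (p i).2.1) - φ.eval N (fun i => (p i).2.2)|

/-- A set of formulas: for each context, the set of its members with variables in that context. -/
abbrev FormulaSet (L : Lang.{u}) := ∀ ⦃n : ℕ⦄ (Γ : Fin n → L.Sorts), Set (Formula L Γ)

/-- The distortion of a relation. -/
def dis {L : Lang.{u}} (Δ : FormulaSet L) {M N : Str.{u, v} L} (R : Set (SProd M N)) : ℝ≥0∞ :=
  ⨆ (k : ℕ) (p : Fin k → SProd M N) (_ : ∀ i, p i ∈ R)
    (φ : Formula L fun i => (p i).1) (_ : φ ∈ Δ fun i => (p i).1), gap p φ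

/-- `R` is a total and surjective relation between the families of sets `A` and `B`. -/
def CorrelatesOn {L : Lang.{u}} {M N : Str.{u, v} L} (A : ∀ s, Set (M.carrier s))
    (B : ∀ s, Set (N.carrier s)) (R : Set (SProd M N)) : Prop :=
  (∀ q ∈ R, q.2.1 ∈ A q.1 ∧ q.2.2 ∈ B q.1) ∧
  (∀ s, ∀ a ∈ A s, ∃ b, (⟨s, a, b⟩ : SProd M N) ∈ R) ∧
  (∀ s, ∀ b ∈ B s, ∃ a, (⟨s, a, b⟩ : SProd M N) ∈ R)

def IsCorrelation {L : Lang.{u}} {M N : Str.{u, v} L} (R : Set (SProd M N)) : Prop :=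
  CorrelatesOn (fun _ => Set.univ) (fun _ => Set.univ) R

/-- `A` is (the family of universes of) a dense sub-pre-structure of `M`. -/
def IsDenseSub {L : Lang.{u}} (M : Str.{u, v} L) (A : ∀ s, Set (M.carrier s)) : Prop :=
  (∀ s, Dense (A s)) ∧
  ∀ (f : L.Fn) (a : ∀ i, M.carrier (L.fnDom f i)),
    (∀ i, a i ∈ A (L.fnDom f i)) → M.fn f a ∈ A (L.fnCod f)

/-- An almost correlation is a correlation between dense sub-pre-structures. -/
def IsAlmostCorrelation {L : Lang.{u}} {M N : Str.{u, v} L} (R : Set (SProd M N)) : Prop :=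
  ∃ A B, IsDenseSub M A ∧ IsDenseSub N B ∧ CorrelatesOn A B R

/-- The `Δ`-distance `ρ_Δ(M, m; N, n)`, where `p` is the pair of tuples `(m, n)`. -/
def rho {L : Lang.{u}} (Δ : FormulaSet L) {M N : Str.{u, v} L} {k : ℕ}
    (p : Fin k → SProd M N) : ℝ≥0∞ :=
  ⨅ (R : Set (SProd M N)) (_ : IsCorrelation R) (_ : ∀ i, p i ∈ R), dis Δ R

/-- The almost `Δ`-similarity `a_Δ(M, m; N, n)`. -/
def almostRho {L : Lang.{u}} (Δ : FormulaSet L) {M N : Str.{u, v} L} {k : ℕ}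
    (p : Fin k → SProd M N) : ℝ≥0∞ :=
  ⨅ (R : Set (SProd M N)) (_ : IsAlmostCorrelation R) (_ : ∀ i, p i ∈ R), dis Δ R

/-! ### Distortion systems -/

/-- `Δ` is a distortion system for `T`. Logical completeness says that a type of `T` is determined
by the values of the formulas of `Δ`. -/
structure IsDistortionSystem {L : Lang.{u}} (T : Theory L) (Δ : FormulaSet L) : Prop where
  logically_complete : ∀ (M N : Str.{u, v} L), M.Models T → N.Models T →
    ∀ (k : ℕ) (p : Fin k → SProd M N),
      (∀ φ ∈ Δ (fun i => (p i).1), gap p φ = 0) → ∀ φ, gap p φ = 0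
  rename_mem : ∀ {n m : ℕ} {Γ : Fin n → L.Sorts} {Γ' : Fin m → L.Sorts} (f : Fin n → Fin m)
    (h : ∀ i, Γ' (f i) = Γ i), ∀ φ ∈ Δ Γ, φ.rename f h ∈ Δ Γ'
  sup_mem : ∀ {n : ℕ} {Γ : Fin n → L.Sorts} {s : L.Sorts}, ∀ φ ∈ Δ (consCtx s Γ), .sup φ ∈ Δ Γ
  inf_mem : ∀ {n : ℕ} {Γ : Fin n → L.Sorts} {s : L.Sorts}, ∀ φ ∈ Δ (consCtx s Γ), .inf φ ∈ Δ Γ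
  const_mem : ∀ {n : ℕ} {Γ : Fin n → L.Sorts} (r : ℝ), .const r ∈ Δ Γ
  lipschitz_conn_mem : ∀ {n : ℕ} {Γ : Fin n → L.Sorts} (F : (ℕ → ℝ) → ℝ) (hF : Continuous F),
    (∀ (x y : ℕ → ℝ) (ε : ℝ), (∀ j, |x j - y j| ≤ ε) → |F x - F y| ≤ ε) →
    ∀ φ : ℕ → Formula L Γ, (∀ j, φ j ∈ Δ Γ) → .conn F hF φ ∈ Δ Γ
  logical_equiv : ∀ {n : ℕ} {Γ : Fin n → L.Sorts} (φ ψ : Formula L Γ), φ ∈ Δ Γ →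
    (∀ M : Str.{u, v} L, M.Models T → ∀ a, φ.eval M a = ψ.eval M a) → ψ ∈ Δ Γ
  uniform_limit : ∀ {n : ℕ} {Γ : Fin n → L.Sorts} (ψ : Formula L Γ),
    (∀ ε > 0, ∃ φ ∈ Δ Γ, ∀ M : Str.{u, v} L, M.Models T → ∀ a,
      |φ.eval M a - ψ.eval M a| ≤ ε) → ψ ∈ Δ Γ

/-- Every closed almost correlation of small distortion is the graph of a uniformly continuous
bijection with uniformly continuous inverse. -/
def IsFunctional {L : Lang.{u}} (T : Theory L) (Δ : FormulaSet L) : Prop :=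
  ∃ ε : ℝ, 0 < ε ∧ ∀ (M N : Str.{u, v} L), M.Models T → N.Models T →
    ∀ R : Set (SProd M N), IsAlmostCorrelation R →
      (∀ s, IsClosed {q : M.carrier s × N.carrier s | (⟨s, q⟩ : SProd M N) ∈ R}) →
      dis Δ R < ENNReal.ofReal ε →
      ∃ e : ∀ s, M.carrier s ≃ᵤ N.carrier s, R = {q | e q.1 q.2.1 = q.2.2}

/-- The relation `R^{<δ}`. -/
def thicken {L : Lang.{u}} {M N : Str.{u, v} L} (R : Set (SProd M N)) (δ : ℝ) :
    Set (SProd M N) :=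
  {q | ∃ c d, (⟨q.1, c, d⟩ : SProd M N) ∈ R ∧ dist q.2.1 c < δ ∧ dist q.2.2 d < δ}

/-- `Δ` is uniformly uniformly continuous. -/
def IsUUC {L : Lang.{u}} (T : Theory L) (Δ : FormulaSet L) : Prop :=
  ∀ ε : ℝ, 0 < ε → ∃ δ : ℝ, 0 < δ ∧ ∀ (M N : Str.{u, v} L), M.Models T → N.Models T →
    ∀ R : Set (SProd M N), IsAlmostCorrelation R →
      dis Δ (thicken R δ) ≤ dis Δ R + ENNReal.ofReal ε

/-! ### Weak moduli and back-and-forth pseudo-metrics -/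

/-- A weak modulus `Ω : [0, ∞)^ω → [0, ∞]`. -/
structure WeakModulus where
  toFun : (ℕ → ℝ≥0) → ℝ≥0∞
  mono : Monotone toFun
  subadditive : ∀ δ δ', toFun (δ + δ') ≤ toFun δ + toFun δ'
  map_zero : toFun 0 = 0
  lowerSemicontinuous : LowerSemicontinuous toFun
  separately_continuous : ∀ (i : ℕ) (δ : ℕ → ℝ≥0),
    Continuous fun t : ℝ≥0 => toFun (Function.update δ i t)

/-- Passing to a subsequence does not increase `Ω`; as `Ω` is nondecreasing, this says that moving
arguments to later positions, in the same order, does not decrease it. -/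
def WeakModulus.ShiftIncreasing (Ω : WeakModulus) : Prop :=
  ∀ (δ : ℕ → ℝ≥0) (σ : ℕ → ℕ), StrictMono σ → Ω.toFun (δ ∘ σ) ≤ Ω.toFun δ

/-- The sequence `0, …, 0, δ 0, …, δ (k - 1), 0, 0, …`, with `δ 0` at position `j`. -/
def place (j : ℕ) {k : ℕ} (δ : Fin k → ℝ≥0) : ℕ → ℝ≥0 :=
  fun l => if h : j ≤ l ∧ l - j < k then δ ⟨l - j, h.2⟩ else 0

/-- The formula `φ(x_j, …, x_{j+k-1})` respects `Ω` in `M`. -/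
def Formula.RespectsAt {L : Lang.{u}} {k : ℕ} {Γ : Fin k → L.Sorts} (φ : Formula L Γ)
    (Ω : WeakModulus) (j : ℕ) (M : Str.{u, v} L) : Prop :=
  ∀ a b : ∀ i, M.carrier (Γ i),
    ENNReal.ofReal |φ.eval M a - φ.eval M b| ≤ Ω.toFun (place j fun i => nndist (a i) (b i))

/-- The `(Δ, Ω)`-back-and-forth pseudo-metrics `r_α(M, m; N, n)` for ordinals `α`, where `p` is the
pair of tuples `(m, n)`. -/
def backForth {L : Lang.{u}} (Δ : FormulaSet L) (Ω : WeakModulus) (M N : Str.{u, v} L)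
    (α : Ordinal.{max u v}) : ∀ k : ℕ, (Fin k → SProd M N) → ℝ≥0∞ :=
  Ordinal.limitRecOn (motive := fun _ => ∀ k : ℕ, (Fin k → SProd M N) → ℝ≥0∞) α
    (fun _ p => ⨆ (ψ : Formula L fun i => (p i).1) (_ : ψ ∈ Δ fun i => (p i).1)
      (_ : ∀ K : Str.{u, v} L, ψ.RespectsAt Ω 0 K), gap p ψ)
    (fun _ r k p => max
      (⨆ (s : L.Sorts) (a : M.carrier s), ⨅ b : N.carrier s,
        r (k + 1) (Fin.snoc (α := fun _ => SProd M N) p ⟨s, a, b⟩))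
      (⨆ (s : L.Sorts) (b : N.carrier s), ⨅ a : M.carrier s,
        r (k + 1) (Fin.snoc (α := fun _ => SProd M N) p ⟨s, a, b⟩)))
    (fun l _ r k p => ⨆ (β : Ordinal.{max u v}) (h : β < l), r β h k p)

/-- `r_∞(M, m; N, n)`, the supremum over all ordinals. -/
def backForthInfty {L : Lang.{u}} (Δ : FormulaSet L) (Ω : WeakModulus) {M N : Str.{u, v} L}
    {k : ℕ} (p : Fin k → SProd M N) : ℝ≥0∞ :=
  ⨆ α : Ordinal.{max u v}, backForth Δ Ω M N α k p

/-- The uniform distance of `φ` and `ψ` over all models of `T` is at most `ε`, where distinct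
variables of `φ` (and of `ψ`) name distinct variables of one common context. -/
def UniformlyWithin {L : Lang.{u}} (T : Theory L) (ε : ℝ) {n m : ℕ} {Γ : Fin n → L.Sorts}
    {Γ' : Fin m → L.Sorts} (φ : Formula L Γ) (ψ : Formula L Γ') : Prop :=
  ∃ (l : ℕ) (Θ : Fin l → L.Sorts) (f : Fin n → Fin l) (hf : ∀ i, Θ (f i) = Γ i)
    (g : Fin m → Fin l) (hg : ∀ i, Θ (g i) = Γ' i), f.Injective ∧ g.Injective ∧
    ∀ M : Str.{u, v} L, M.Models T → ∀ a : ∀ i, M.carrier (Θ i),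
      |(φ.rename f hf).eval M a - (ψ.rename g hg).eval M a| ≤ ε

/-- The sequence `φ` of formulas lies in `Δ` and is dense in `Δ` for the uniform norm. -/
def IsDenseSeq {L : Lang.{u}} (T : Theory L) (Δ : FormulaSet L)
    (φ : ℕ → Σ (n : ℕ) (Γ : Fin n → L.Sorts), Formula L Γ) : Prop :=
  (∀ i, (φ i).2.2 ∈ Δ (φ i).2.1) ∧
  ∀ (n : ℕ) (Γ : Fin n → L.Sorts), ∀ ψ ∈ Δ Γ, ∀ ε : ℝ, 0 < ε →
    ∃ i, UniformlyWithin.{u, v} T ε (φ i).2.2 ψ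

end MetricLogic

end

/-!
The comparison of `r_∞` with `ρ_Δ` rests on playing the back-and-forth game.

A correlation of distortion at most `t` is a strategy keeping all gaps of formulas below `t`, and an
almost correlation still is one because `r_α` has modulus `Ω` in its arguments
(`backForth_le_add_place`). This gives `r_∞ ≤ a_Δ ≤ ρ_Δ` (`backForth_le_dis`), and with the
triangle inequality (`backForth_triangle`) the Lipschitz property in `ρ_Δ`.

For the converse inequalities, let `r_∞ < t`. If there is a sort at all, the hierarchy `r_α`
stabilizes (`IsDistortionSystem.exists_stable`), so the game can be played for infinitely many
rounds with `r_∞ < t` throughout, running infinitely often through countable dense substructures of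
the two separable models (`IsDistortionSystem.exists_play`). The pseudo-metric `r_0` only sees formulas that
respect `Ω` in every structure, but a formula of `Δ` respecting it in the models of `T` is
equivalent to such a formula, its inf-convolution with `Ω` (`IsDistortionSystem.exists_respects`).

If all formulas of `Δ` respect `Ω`, the pairs played form an almost correlation of distortion at
most `t`, and uniform uniform continuity turns it into a correlation of almost the same distortion
(`IsUUC.rho_le_backForthInfty`).

In the functional case only a dense sequence of formulas is known to respect `Ω`, from some position
on and with their variables in one particular order. A formula of `Δ` is then controlled at suitably chosen
increasing positions, but perhaps not at all late positions (`IsDistortionSystem.controls`). This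
suffices to bound the distortion of the set of cluster points of the play
(`Controls.dis_clusterSet_le`). That every element of either model has a partner in the cluster set
is a compactness property. For a formula `θ` and two elements `x`, `x'`, the variation
`½ sup_y |θ(x, y) - θ(x', y)|` belongs to `Δ`. Adding a pair `(b, b')` with `b ≠ b'` to the diagonal
of a model gives a closed correlation that is not a graph, so functionality bounds the variation of
some `θ` at `(b, b')` from below. An ultraproduct argument makes this uniform: for each `δ`
a single formula of `Δ` in two variables vanishes on the diagonal and is bounded below on pairs at
distance at least `δ`, by a constant independent of `δ` (`FunctionalBelow.exists_separating`). Hence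
the partners of a convergent sequence of elements cannot contain an infinite `δ`-separated set, for
its two halves would violate the control of this formula (`Controls.totallyBounded`), and they have
a cluster point.
-/

noncomputable section

namespace MetricLogic

open Filter Topology

variable {L : Lang.{u}}

/-! ### Values of formulas -/

/-- The assignment `a` with the value `x` put in front, for a context extended by `consCtx`. -/
abbrev consVal (M : Str.{u, v} L) {n : ℕ} {Γ : Fin n → L.Sorts} {s : L.Sorts} (x : M.carrier s)
    (a : ∀ i, M.carrier (Γ i)) : ∀ i, M.carrier (consCtx s Γ i) :=
  Fin.cons (α := fun i => M.carrier (consCtx s Γ i)) x a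

theorem Formula.exists_bound {n : ℕ} {Γ : Fin n → L.Sorts} (φ : Formula L Γ) :
    ∃ C : ℝ, ∀ (M : Str.{u, v} L) a, |φ.eval M a| ≤ C := by
  induction φ with
  | const r => exact ⟨|r|, fun M a => le_rfl⟩
  | @dist n Γ s t₁ t₂ =>
    refine ⟨L.diam s, fun M a => ?_⟩
    simp only [Formula.eval]
    rw [abs_of_nonneg dist_nonneg]
    exact M.dist_le _ _ _
  | pred P t =>
    refine ⟨max |L.predLo P| |L.predHi P|, fun M a => ?_⟩
    have h := M.pred_mem P fun i => (t i).eval M a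
    exact abs_le_max_abs_abs h.1 h.2
  | @conn n Γ F hF φ ih =>
    choose C hC using ih
    have hK : IsCompact (Set.univ.pi fun j => Set.Icc (-C j) (C j)) :=
      isCompact_univ_pi fun j => isCompact_Icc
    obtain ⟨B, hB⟩ := hK.exists_bound_of_continuousOn hF.continuousOn
    exact ⟨B, fun M a => hB _ fun j _ => abs_le.1 (hC j M a)⟩
  | sup φ ih =>
    obtain ⟨C, hC⟩ := ih
    refine ⟨C, fun M a => ?_⟩
    simp only [Formula.eval]
    have hb : BddAbove (Set.range fun x => φ.eval M (consVal M x a)) :=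
      ⟨C, by rintro _ ⟨x, rfl⟩; exact (abs_le.1 (hC M _)).2⟩
    refine abs_le.2 ⟨?_, ciSup_le fun x => (abs_le.1 (hC M _)).2⟩
    obtain ⟨x⟩ := M.nonempty _
    exact (abs_le.1 (hC M _)).1.trans (le_ciSup hb x)
  | inf φ ih =>
    obtain ⟨C, hC⟩ := ih
    refine ⟨C, fun M a => ?_⟩
    simp only [Formula.eval]
    have hb : BddBelow (Set.range fun x => φ.eval M (consVal M x a)) :=
      ⟨-C, by rintro _ ⟨x, rfl⟩; exact (abs_le.1 (hC M _)).1⟩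
    refine abs_le.2 ⟨le_ciInf fun x => (abs_le.1 (hC M _)).1, ?_⟩
    obtain ⟨x⟩ := M.nonempty _
    exact (ciInf_le hb x).trans (abs_le.1 (hC M _)).2

theorem Formula.bddAbove_range {n : ℕ} {Γ : Fin n → L.Sorts} (φ : Formula L Γ) (M : Str.{u, v} L)
    {ι : Sort*} (f : ι → ∀ i, M.carrier (Γ i)) : BddAbove (Set.range fun x => φ.eval M (f x)) := by
  obtain ⟨C, hC⟩ := φ.exists_bound
  exact ⟨C, by rintro _ ⟨x, rfl⟩; exact (abs_le.1 (hC M _)).2⟩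

theorem Formula.bddBelow_range {n : ℕ} {Γ : Fin n → L.Sorts} (φ : Formula L Γ) (M : Str.{u, v} L)
    {ι : Sort*} (f : ι → ∀ i, M.carrier (Γ i)) : BddBelow (Set.range fun x => φ.eval M (f x)) := by
  obtain ⟨C, hC⟩ := φ.exists_bound
  exact ⟨-C, by rintro _ ⟨x, rfl⟩; exact (abs_le.1 (hC M _)).1⟩

theorem Formula.isLUB_eval_sup {n : ℕ} {Γ : Fin n → L.Sorts} {s : L.Sorts}
    (φ : Formula L (consCtx s Γ)) (M : Str.{u, v} L) (a : ∀ i, M.carrier (Γ i)) :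
    IsLUB (Set.range fun x => φ.eval M (consVal M x a)) (φ.sup.eval M a) := by
  simp only [Formula.eval]
  exact isLUB_ciSup (φ.bddAbove_range M _)

theorem Formula.isGLB_eval_inf {n : ℕ} {Γ : Fin n → L.Sorts} {s : L.Sorts}
    (φ : Formula L (consCtx s Γ)) (M : Str.{u, v} L) (a : ∀ i, M.carrier (Γ i)) :
    IsGLB (Set.range fun x => φ.eval M (consVal M x a)) (φ.inf.eval M a) := by
  simp only [Formula.eval]
  exact isGLB_ciInf (φ.bddBelow_range M _)

theorem Term.uniformContinuous_eval (M : Str.{u, v} L) {n : ℕ} {Γ : Fin n → L.Sorts}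
    {s : L.Sorts} (t : Term L Γ s) : UniformContinuous fun a => t.eval M a := by
  induction t with
  | var i => exact Pi.uniformContinuous_proj _ i
  | app f t ih =>
    have h : UniformContinuous (M.fn f) := by
      refine Metric.uniformContinuous_iff.2 fun ε hε => ⟨L.fnMod f (ε / 2),
        L.fnMod_pos f _ (half_pos hε), fun {a b} hab => ?_⟩
      refine (M.fn_unif f _ (half_pos hε) a b fun i => ?_).trans_lt (half_lt_self hε)
      exact (dist_le_pi_dist a b i).trans_lt hab
    exact h.comp (uniformContinuous_pi.2 ih)

theorem consVal_dist_lt (M : Str.{u, v} L) {n : ℕ} {Γ : Fin n → L.Sorts} {s : L.Sorts}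
    (x : M.carrier s) {a b : ∀ i, M.carrier (Γ i)} {δ : ℝ} (hδ : 0 < δ) (h : dist a b < δ) :
    dist (consVal M x a) (consVal M x b) < δ := by
  refine (dist_pi_lt_iff hδ).2 (Fin.cases ?_ fun i => ?_)
  · change dist x x < δ
    simpa using hδ
  · exact (dist_le_pi_dist a b i).trans_lt h

theorem Formula.uniformContinuous_eval (M : Str.{u, v} L) {n : ℕ} {Γ : Fin n → L.Sorts}
    (φ : Formula L Γ) : UniformContinuous fun a => φ.eval M a := by
  induction φ with
  | const r => exact uniformContinuous_const
  | dist t₁ t₂ => exact (t₁.uniformContinuous_eval M).dist (t₂.uniformContinuous_eval M)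
  | pred P t =>
    have h : UniformContinuous (M.pred P) := by
      refine Metric.uniformContinuous_iff.2 fun ε hε => ⟨L.predMod P (ε / 2),
        L.predMod_pos P _ (half_pos hε), fun {a b} hab => ?_⟩
      refine (M.pred_unif P _ (half_pos hε) a b fun i => ?_).trans_lt (half_lt_self hε)
      exact (dist_le_pi_dist a b i).trans_lt hab
    exact h.comp (uniformContinuous_pi.2 fun i => (t i).uniformContinuous_eval M)
  | @conn n Γ F hF φ ih =>
    choose C hC using fun j => (φ j).exists_bound
    have hK : IsCompact (Set.univ.pi fun j => Set.Icc (-C j) (C j)) :=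
      isCompact_univ_pi fun j => isCompact_Icc
    have h := hK.uniformContinuousOn_of_continuous hF.continuousOn
    rw [uniformContinuousOn_iff_restrict] at h
    have h2 : UniformContinuous fun a : ∀ i, M.carrier (Γ i) =>
        (⟨fun j => (φ j).eval M a, fun j _ => abs_le.1 (hC j M a)⟩ :
          Set.univ.pi fun j => Set.Icc (-C j) (C j)) :=
      UniformContinuous.subtype_mk (uniformContinuous_pi.2 ih) _
    exact h.comp h2
  | sup φ ih =>
    refine Metric.uniformContinuous_iff.2 fun ε hε => ?_
    obtain ⟨δ, hδ, h⟩ := Metric.uniformContinuous_iff.1 ih (ε / 2) (half_pos hε)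
    have key : ∀ a b, Dist.dist a b < δ → φ.sup.eval M a ≤ φ.sup.eval M b + ε / 2 := by
      intro a b hab
      refine (φ.isLUB_eval_sup M a).2 ?_
      rintro _ ⟨x, rfl⟩
      have h1 := (φ.isLUB_eval_sup M b).1 ⟨x, rfl⟩
      have h2 := abs_lt.1 (h (consVal_dist_lt M x hδ hab))
      dsimp only at h1 ⊢
      linarith [h2.2]
    refine ⟨δ, hδ, fun {a b} hab => ?_⟩
    rw [Real.dist_eq, abs_lt]
    have h1 := key a b hab
    have h2 := key b a (by rwa [dist_comm])
    constructor <;> linarith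
  | inf φ ih =>
    refine Metric.uniformContinuous_iff.2 fun ε hε => ?_
    obtain ⟨δ, hδ, h⟩ := Metric.uniformContinuous_iff.1 ih (ε / 2) (half_pos hε)
    have key : ∀ a b, Dist.dist a b < δ → φ.inf.eval M a - ε / 2 ≤ φ.inf.eval M b := by
      intro a b hab
      refine (φ.isGLB_eval_inf M b).2 ?_
      rintro _ ⟨x, rfl⟩
      have h1 := (φ.isGLB_eval_inf M a).1 ⟨x, rfl⟩
      have h2 := abs_lt.1 (h (consVal_dist_lt M x hδ hab))
      dsimp only at h1 ⊢
      linarith [h2.2]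
    refine ⟨δ, hδ, fun {a b} hab => ?_⟩
    rw [Real.dist_eq, abs_lt]
    have h1 := key a b hab
    have h2 := key b a (by rwa [dist_comm])
    constructor <;> linarith

theorem Term.eval_rename (M : Str.{u, v} L) {n m : ℕ} {Γ : Fin n → L.Sorts}
    {Γ' : Fin m → L.Sorts} (f : Fin n → Fin m) (h : ∀ i, Γ' (f i) = Γ i) {s : L.Sorts}
    (t : Term L Γ s) (a : ∀ i, M.carrier (Γ' i)) (a' : ∀ i, M.carrier (Γ i))
    (ha : ∀ i, a' i ≍ a (f i)) : (t.rename f h).eval M a = t.eval M a' := by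
  induction t with
  | var i =>
    have key : ∀ (s : L.Sorts) (e : Γ' (f i) = s) (x : M.carrier s), x ≍ a (f i) →
        (e ▸ Term.var (L := L) (Γ := Γ') (f i) : Term L Γ' s).eval M a = x := by
      rintro s rfl x hx
      exact (eq_of_heq hx).symm
    exact key _ (h i) _ (ha i)
  | app g t ih =>
    simp only [Term.rename, Term.eval]
    congr 1
    exact funext ih

/-- Renaming variables amounts to pulling back assignments. The assignment `a'` is compared with
the pullback of `a` by heterogeneous equality, as the sorts only agree propositionally. -/
theorem Formula.eval_rename (M : Str.{u, v} L) {n m : ℕ} {Γ : Fin n → L.Sorts}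
    {Γ' : Fin m → L.Sorts} (f : Fin n → Fin m) (h : ∀ i, Γ' (f i) = Γ i)
    (φ : Formula L Γ) (a : ∀ i, M.carrier (Γ' i)) (a' : ∀ i, M.carrier (Γ i))
    (ha : ∀ i, a' i ≍ a (f i)) : (φ.rename f h).eval M a = φ.eval M a' := by
  have lift : ∀ {n m : ℕ} {Γ : Fin n → L.Sorts} {Γ' : Fin m → L.Sorts} (f : Fin n → Fin m)
      (a : ∀ i, M.carrier (Γ' i)) (a' : ∀ i, M.carrier (Γ i)), (∀ i, a' i ≍ a (f i)) →
      ∀ {s : L.Sorts} (x : M.carrier s) (i),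
        consVal M x a' i ≍ consVal M x a (liftRen f i) := by
    intro n m Γ Γ' f a a' ha s x
    exact Fin.cases HEq.rfl ha
  induction φ generalizing m with
  | const r => rfl
  | dist t₁ t₂ =>
    simp only [Formula.rename, Formula.eval, t₁.eval_rename M f h a a' ha,
      t₂.eval_rename M f h a a' ha]
  | pred P t =>
    simp only [Formula.rename, Formula.eval, fun i => (t i).eval_rename M f h a a' ha]
  | conn F hF φ ih =>
    simp only [Formula.rename, Formula.eval, fun j => ih j f h a a' ha]
  | sup φ ih =>
    simp only [Formula.rename, Formula.eval]
    exact iSup_congr fun x => ih _ _ _ _ (lift f a a' ha x)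
  | inf φ ih =>
    simp only [Formula.rename, Formula.eval]
    exact iInf_congr fun x => ih _ _ _ _ (lift f a a' ha x)

/-! ### Simultaneous quantification over several variables -/

/-- The context `Θ` of `n` variables put in front of the context `Γ`. -/
def joinCtx {S : Type u} : {n : ℕ} → (Fin n → S) → {k : ℕ} → (Fin k → S) → Fin (k + n) → S
  | 0, _, _, Γ => Γ
  | _ + 1, Θ, _, Γ => consCtx (Θ 0) (joinCtx (fun i => Θ i.succ) Γ)

/-- The assignment in the context `joinCtx Θ Γ` that is made of `y` and `x`. -/
def joinVal (M : Str.{u, v} L) : {n : ℕ} → {Θ : Fin n → L.Sorts} → (∀ i, M.carrier (Θ i)) →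
    {k : ℕ} → {Γ : Fin k → L.Sorts} → (∀ i, M.carrier (Γ i)) → ∀ i, M.carrier (joinCtx Θ Γ i)
  | 0, _, _, _, _, x => x
  | _ + 1, _, y, _, _, x => consVal M (y 0) (joinVal M (fun i => y i.succ) x)

/-- The position in `joinCtx Θ Γ` of a variable of `Θ`. -/
def joinLeft : {n : ℕ} → (k : ℕ) → Fin n → Fin (k + n)
  | 0, _, i => i.elim0
  | n + 1, k, i => Fin.cases (motive := fun _ => Fin (k + n + 1)) 0
      (fun j => (joinLeft k j).succ) i

/-- The position in `joinCtx Θ Γ` of a variable of `Γ`. -/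
def joinRight : (n : ℕ) → {k : ℕ} → Fin k → Fin (k + n)
  | 0, _, i => i
  | n + 1, _, i => (joinRight n i).succ

theorem joinCtx_left {S : Type u} {n : ℕ} (Θ : Fin n → S) {k : ℕ} (Γ : Fin k → S) (i : Fin n) :
    joinCtx Θ Γ (joinLeft k i) = Θ i := by
  induction n with
  | zero => exact i.elim0
  | succ n ih =>
    refine Fin.cases ?_ (fun j => ?_) i
    · rfl
    · exact ih (fun i => Θ i.succ) j

theorem joinCtx_right {S : Type u} {n : ℕ} (Θ : Fin n → S) {k : ℕ} (Γ : Fin k → S) (i : Fin k) :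
    joinCtx Θ Γ (joinRight n i) = Γ i := by
  induction n with
  | zero => rfl
  | succ n ih => exact ih (fun i => Θ i.succ)

theorem joinVal_left (M : Str.{u, v} L) {n : ℕ} {Θ : Fin n → L.Sorts} (y : ∀ i, M.carrier (Θ i))
    {k : ℕ} {Γ : Fin k → L.Sorts} (x : ∀ i, M.carrier (Γ i)) (i : Fin n) :
    joinVal M y x (joinLeft k i) ≍ y i := by
  induction n with
  | zero => exact i.elim0
  | succ n ih =>
    refine Fin.cases ?_ (fun j => ?_) i
    · exact HEq.rfl
    · exact ih (fun i => y i.succ) j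

theorem joinVal_right (M : Str.{u, v} L) {n : ℕ} {Θ : Fin n → L.Sorts}
    (y : ∀ i, M.carrier (Θ i)) {k : ℕ} {Γ : Fin k → L.Sorts} (x : ∀ i, M.carrier (Γ i))
    (i : Fin k) : joinVal M y x (joinRight n i) ≍ x i := by
  induction n with
  | zero => exact HEq.rfl
  | succ n ih => exact ih (fun i => y i.succ)

/-- Quantify the variables of `Θ` by suprema. -/
def Formula.sups : {n : ℕ} → {Θ : Fin n → L.Sorts} → {k : ℕ} → {Γ : Fin k → L.Sorts} →
    Formula L (joinCtx Θ Γ) → Formula L Γ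
  | 0, _, _, _, φ => φ
  | n + 1, Θ, _, _, φ => Formula.sups (n := n) (Θ := fun i => Θ i.succ)
      (Formula.sup (s := Θ 0) φ)

/-- Quantify the variables of `Θ` by infima. -/
def Formula.infs : {n : ℕ} → {Θ : Fin n → L.Sorts} → {k : ℕ} → {Γ : Fin k → L.Sorts} →
    Formula L (joinCtx Θ Γ) → Formula L Γ
  | 0, _, _, _, φ => φ
  | n + 1, Θ, _, _, φ => Formula.infs (n := n) (Θ := fun i => Θ i.succ)
      (Formula.inf (s := Θ 0) φ)

theorem Formula.isLUB_eval_sups (M : Str.{u, v} L) {n : ℕ} {Θ : Fin n → L.Sorts} {k : ℕ}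
    {Γ : Fin k → L.Sorts} (φ : Formula L (joinCtx Θ Γ)) (x : ∀ i, M.carrier (Γ i)) :
    IsLUB (Set.range fun y : ∀ i, M.carrier (Θ i) => φ.eval M (joinVal M y x))
      (φ.sups.eval M x) := by
  induction n with
  | zero =>
    have : (Set.range fun y : ∀ i, M.carrier (Θ i) => φ.eval M (joinVal M y x)) =
        {φ.eval M x} := by
      ext r
      constructor
      · rintro ⟨y, rfl⟩; rfl
      · rintro rfl; exact ⟨fun i => i.elim0, rfl⟩
    rw [this]
    exact isLUB_singleton
  | succ n ih =>
    have h1 := ih (Θ := fun i => Θ i.succ) (Formula.sup (s := Θ 0) φ)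
    refine ⟨?_, fun B hB => h1.2 ?_⟩
    · rintro _ ⟨y, rfl⟩
      exact ((Formula.isLUB_eval_sup (s := Θ 0) φ M _).1 ⟨y 0, rfl⟩).trans
        (h1.1 ⟨fun i => y i.succ, rfl⟩)
    · rintro _ ⟨y, rfl⟩
      refine (Formula.isLUB_eval_sup (s := Θ 0) φ M _).2 ?_
      rintro _ ⟨z, rfl⟩
      exact hB ⟨Fin.cons (α := fun i => M.carrier (Θ i)) z y, rfl⟩

theorem Formula.isGLB_eval_infs (M : Str.{u, v} L) {n : ℕ} {Θ : Fin n → L.Sorts} {k : ℕ}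
    {Γ : Fin k → L.Sorts} (φ : Formula L (joinCtx Θ Γ)) (x : ∀ i, M.carrier (Γ i)) :
    IsGLB (Set.range fun y : ∀ i, M.carrier (Θ i) => φ.eval M (joinVal M y x))
      (φ.infs.eval M x) := by
  induction n with
  | zero =>
    have : (Set.range fun y : ∀ i, M.carrier (Θ i) => φ.eval M (joinVal M y x)) =
        {φ.eval M x} := by
      ext r
      constructor
      · rintro ⟨y, rfl⟩; rfl
      · rintro rfl; exact ⟨fun i => i.elim0, rfl⟩
    rw [this]
    exact isGLB_singleton
  | succ n ih =>
    have h1 := ih (Θ := fun i => Θ i.succ) (Formula.inf (s := Θ 0) φ)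
    refine ⟨?_, fun B hB => h1.2 ?_⟩
    · rintro _ ⟨y, rfl⟩
      exact (h1.1 ⟨fun i => y i.succ, rfl⟩).trans
        ((Formula.isGLB_eval_inf (s := Θ 0) φ M _).1 ⟨y 0, rfl⟩)
    · rintro _ ⟨y, rfl⟩
      refine (Formula.isGLB_eval_inf (s := Θ 0) φ M _).2 ?_
      rintro _ ⟨z, rfl⟩
      exact hB ⟨Fin.cons (α := fun i => M.carrier (Θ i)) z y, rfl⟩

theorem IsDistortionSystem.sups_mem {T : Theory L} {Δ : FormulaSet L}
    (hΔ : IsDistortionSystem.{u, v} T Δ) {n : ℕ} {Θ : Fin n → L.Sorts} {k : ℕ}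
    {Γ : Fin k → L.Sorts} (φ : Formula L (joinCtx Θ Γ)) (hφ : φ ∈ Δ (joinCtx Θ Γ)) :
    φ.sups ∈ Δ Γ := by
  induction n with
  | zero => exact hφ
  | succ n ih => exact ih (Θ := fun i => Θ i.succ) _ (hΔ.sup_mem (s := Θ 0) φ hφ)

/-! ### Weak moduli on finitely supported sequences -/

theorem WeakModulus.tendsto_single (Ω : WeakModulus) (i : ℕ) :
    Tendsto (fun t : ℝ≥0 => Ω.toFun (Pi.single i t)) (𝓝 0) (𝓝 0) := by
  have h := (Ω.separately_continuous i 0).tendsto 0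
  change Tendsto (fun t : ℝ≥0 => Ω.toFun (Pi.single i t)) (𝓝 0) (𝓝 (Ω.toFun (Pi.single i 0))) at h
  rwa [Pi.single_zero, Ω.map_zero] at h

/-- A weak modulus is finite in each argument: it is finite near `0` by continuity, hence
everywhere by subadditivity. -/
theorem WeakModulus.single_ne_top (Ω : WeakModulus) (i : ℕ) (t : ℝ≥0) :
    Ω.toFun (Pi.single i t) ≠ ∞ := by
  have hmul : ∀ (n : ℕ) (x : ℝ≥0), Ω.toFun (Pi.single i (n • x)) ≤
      n • Ω.toFun (Pi.single i x) := by
    intro n x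
    induction n with
    | zero => simp [Ω.map_zero]
    | succ n ih =>
      rw [succ_nsmul, Pi.single_add, succ_nsmul]
      exact (Ω.subadditive _ _).trans (add_le_add_left ih _)
  have hev := (Ω.tendsto_single i).eventually_lt_const one_pos
  obtain ⟨ε, hε, h⟩ := Metric.eventually_nhds_iff.1 hev
  obtain ⟨x, hx0, hx⟩ : ∃ x : ℝ≥0, 0 < x ∧ (x : ℝ) < ε := by
    refine ⟨(ε / 2).toNNReal, by simpa using hε, ?_⟩
    rw [Real.coe_toNNReal _ (half_pos hε).le]
    exact half_lt_self hε
  have h1 : Ω.toFun (Pi.single i x) < 1 := by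
    apply h
    rw [NNReal.dist_eq, NNReal.coe_zero, sub_zero, NNReal.abs_eq]
    exact hx
  obtain ⟨n, hn⟩ := Archimedean.arch t hx0
  refine ne_top_of_le_ne_top ?_ ((Ω.mono (Pi.single_mono i hn)).trans (hmul n x))
  rw [nsmul_eq_mul]
  exact ENNReal.mul_ne_top (by simp) (h1.trans ENNReal.one_lt_top).ne

theorem place_eq_zero {j k : ℕ} (δ : Fin k → ℝ≥0) {l : ℕ} (h : ¬(j ≤ l ∧ l - j < k)) :
    place j δ l = 0 := dif_neg h

theorem place_zero_apply {k : ℕ} (δ : Fin k → ℝ≥0) (i : Fin k) : place 0 δ i = δ i := by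
  unfold place
  rw [dif_pos (by simp)]
  rfl

theorem place_add_apply {k : ℕ} (j : ℕ) (δ : Fin k → ℝ≥0) (i : Fin k) :
    place j δ (j + i) = δ i := by
  unfold place
  rw [dif_pos (by simp)]
  congr 1
  ext
  simp

/-- A position in `place j δ` carries an entry of `δ`, or lies outside their range. -/
theorem place_cases {k : ℕ} (j l : ℕ) : (∃ i : Fin k, l = j + i) ∨ ¬(j ≤ l ∧ l - j < k) := by
  by_cases h : j ≤ l ∧ l - j < k
  · exact .inl ⟨⟨l - j, h.2⟩, by simp; omega⟩
  · exact .inr h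

theorem place_mono {k : ℕ} (j : ℕ) {δ δ' : Fin k → ℝ≥0} (h : δ ≤ δ') : place j δ ≤ place j δ' := by
  intro l
  rcases place_cases (k := k) j l with ⟨i, rfl⟩ | hl
  · rw [place_add_apply, place_add_apply]
    exact h i
  · rw [place_eq_zero _ hl, place_eq_zero _ hl]

theorem place_zero_le_add_sum {k : ℕ} (δ δ' : Fin k → ℝ≥0) :
    place 0 δ ≤ place 0 δ' + ∑ i : Fin k, Pi.single (i : ℕ) (δ i - δ' i) := by
  intro l
  simp only [Pi.add_apply, Finset.sum_apply]
  rcases place_cases (k := k) 0 l with ⟨i, rfl⟩ | hl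
  · rw [zero_add, place_zero_apply, place_zero_apply]
    calc δ i ≤ δ' i + (δ i - δ' i) := le_add_tsub
      _ = δ' i + (Pi.single (i : ℕ) (δ i - δ' i) : ℕ → ℝ≥0) i := by simp
      _ ≤ _ := by
        gcongr
        exact Finset.single_le_sum
          (f := fun j : Fin k => (Pi.single (j : ℕ) (δ j - δ' j) : ℕ → ℝ≥0) i)
          (fun _ _ => zero_le) (Finset.mem_univ i)
  · rw [place_eq_zero _ hl]
    exact zero_le

theorem WeakModulus.toFun_sum_le (Ω : WeakModulus) {ι : Type*} (s : Finset ι)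
    (f : ι → ℕ → ℝ≥0) : Ω.toFun (∑ i ∈ s, f i) ≤ ∑ i ∈ s, Ω.toFun (f i) := by
  classical
  induction s using Finset.induction_on with
  | empty => simp [Ω.map_zero]
  | insert a s ha ih =>
    rw [Finset.sum_insert ha, Finset.sum_insert ha]
    exact (Ω.subadditive _ _).trans (add_le_add_right ih _)

theorem WeakModulus.place_le (Ω : WeakModulus) {k : ℕ} (δ δ' : Fin k → ℝ≥0) :
    Ω.toFun (place 0 δ) ≤ Ω.toFun (place 0 δ') +
      ∑ i : Fin k, Ω.toFun (Pi.single (i : ℕ) (δ i - δ' i)) :=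
  (Ω.mono (place_zero_le_add_sum δ δ')).trans <| (Ω.subadditive _ _).trans <|
    add_le_add_right (Ω.toFun_sum_le _ _) _

theorem place_zero_eq_zero {k : ℕ} : place 0 (0 : Fin k → ℝ≥0) = 0 := by
  funext l
  rcases place_cases (k := k) 0 l with ⟨i, rfl⟩ | hl
  · rw [place_add_apply]; rfl
  · rw [place_eq_zero _ hl]; rfl

theorem WeakModulus.place_ne_top (Ω : WeakModulus) {k : ℕ} (δ : Fin k → ℝ≥0) :
    Ω.toFun (place 0 δ) ≠ ∞ := by
  refine ne_top_of_le_ne_top ?_ (Ω.place_le δ 0)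
  rw [place_zero_eq_zero, Ω.map_zero, zero_add]
  exact ENNReal.sum_ne_top.2 fun i _ => Ω.single_ne_top _ _

theorem WeakModulus.continuous_place (Ω : WeakModulus) (k : ℕ) :
    Continuous fun δ : Fin k → ℝ≥0 => (Ω.toFun (place 0 δ)).toReal := by
  refine continuous_iff_continuousAt.2 fun δ₀ => ?_
  refine (ENNReal.tendsto_toReal (Ω.place_ne_top δ₀)).comp ?_
  have hsum : ∀ f : (Fin k → ℝ≥0) → Fin k → ℝ≥0, Continuous f → f δ₀ = 0 →
      Tendsto (fun δ => ∑ i : Fin k, Ω.toFun (Pi.single (i : ℕ) (f δ i)))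
        (𝓝 δ₀) (𝓝 0) := by
    intro f hf h0
    have : Tendsto (fun δ => ∑ i : Fin k, Ω.toFun (Pi.single (i : ℕ) (f δ i)))
        (𝓝 δ₀) (𝓝 (∑ _i : Fin k, 0)) := by
      refine tendsto_finsetSum _ fun i _ => (Ω.tendsto_single i).comp ?_
      have := ((continuous_apply i).comp hf).tendsto δ₀
      simpa [h0, Function.comp_def] using this
    simpa using this
  have h1 := hsum (fun δ i => δ i - δ₀ i) (by fun_prop) (by funext i; simp)
  have h2 := hsum (fun δ i => δ₀ i - δ i) (by fun_prop) (by funext i; simp)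
  refine ENNReal.tendsto_nhds (Ω.place_ne_top δ₀) |>.2 fun ε hε => ?_
  filter_upwards [h1.eventually_le_const hε, h2.eventually_le_const hε] with δ hδ1 hδ2
  constructor
  · exact tsub_le_iff_right.2 ((Ω.place_le δ₀ δ).trans (add_le_add_right hδ2 _))
  · exact (Ω.place_le δ δ₀).trans (add_le_add_right hδ1 _)

theorem place_add {k : ℕ} (j : ℕ) (δ δ' : Fin k → ℝ≥0) :
    place j (δ + δ') = place j δ + place j δ' := by
  funext l
  rw [Pi.add_apply]
  rcases place_cases (k := k) j l with ⟨i, rfl⟩ | hl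
  · rw [place_add_apply, place_add_apply, place_add_apply]; rfl
  · rw [place_eq_zero _ hl, place_eq_zero _ hl, place_eq_zero _ hl, add_zero]

/-! ### Formulas respecting the modulus in every structure -/

/-- The inf-convolution of `χ` with the modulus `Ω`, a formula for
`x ↦ inf_y (χ(y) + Ω(d(x₀, y₀), d(x₁, y₁), …))`. -/
theorem exists_infConvolution (Ω : WeakModulus) {k : ℕ} {Γ : Fin k → L.Sorts}
    (χ : Formula L Γ) : ∃ χ' : Formula L Γ, ∀ (M : Str.{u, v} L) (x : ∀ i, M.carrier (Γ i)),
      IsGLB (Set.range fun y : ∀ i, M.carrier (Γ i) => χ.eval M y +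
        (Ω.toFun (place 0 fun i => nndist (x i) (y i))).toReal) (χ'.eval M x) := by
  have hl := joinCtx_left Γ Γ
  have hr := joinCtx_right (n := k) Γ Γ
  let F : (ℕ → ℝ) → ℝ := fun r =>
    r k + (Ω.toFun (place 0 fun i : Fin k => (r i).toNNReal)).toReal
  have hF : Continuous F := by
    refine (continuous_apply k).add ((Ω.continuous_place k).comp ?_)
    fun_prop
  let t₁ : ∀ i : Fin k, Term L (joinCtx Γ Γ) (Γ i) := fun i =>
    (Term.var i : Term L Γ (Γ i)).rename (joinRight k) hr
  let t₂ : ∀ i : Fin k, Term L (joinCtx Γ Γ) (Γ i) := fun i =>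
    (Term.var i : Term L Γ (Γ i)).rename (joinLeft k) hl
  let φ : ℕ → Formula L (joinCtx Γ Γ) := fun j =>
    if h : j < k then .dist (t₁ ⟨j, h⟩) (t₂ ⟨j, h⟩) else χ.rename (joinLeft k) hl
  refine ⟨(Formula.conn F hF φ).infs, fun M x => ?_⟩
  have key : ∀ y : ∀ i, M.carrier (Γ i), (Formula.conn F hF φ).eval M (joinVal M y x) =
      χ.eval M y + (Ω.toFun (place 0 fun i => nndist (x i) (y i))).toReal := by
    intro y
    simp only [Formula.eval, F]
    congr 1
    · simp only [φ, lt_irrefl, dif_neg, not_false_eq_true]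
      exact χ.eval_rename M _ hl _ _ fun i => (joinVal_left M y x i).symm
    · congr 3
      funext i
      simp only [φ, i.isLt, dif_pos, Formula.eval, t₁, t₂]
      rw [Term.eval_rename M _ hr _ _ x fun i => (joinVal_right M y x i).symm,
        Term.eval_rename M _ hl _ _ y fun i => (joinVal_left M y x i).symm]
      exact NNReal.eq (Real.coe_toNNReal _ dist_nonneg)
  simpa only [key] using (Formula.conn F hF φ).isGLB_eval_infs M x

/-- A formula of a distortion system respecting `Ω` in the models of `T` is equivalent modulo `T`
to one respecting `Ω` in every structure, namely to its inf-convolution with `Ω`. -/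
theorem IsDistortionSystem.exists_respects {T : Theory L} {Δ : FormulaSet L}
    (hΔ : IsDistortionSystem.{u, v} T Δ) (Ω : WeakModulus) {k : ℕ} {Γ : Fin k → L.Sorts}
    (χ : Formula L Γ) (hχ : χ ∈ Δ Γ)
    (hΩ : ∀ K : Str.{u, v} L, K.Models T → χ.RespectsAt Ω 0 K) :
    ∃ χ' ∈ Δ Γ, (∀ K : Str.{u, v} L, χ'.RespectsAt Ω 0 K) ∧
      ∀ K : Str.{u, v} L, K.Models T → ∀ a, χ.eval K a = χ'.eval K a := by
  obtain ⟨χ', h⟩ := exists_infConvolution.{u, v} Ω χ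
  have heq : ∀ K : Str.{u, v} L, K.Models T → ∀ a, χ.eval K a = χ'.eval K a := by
    intro K hK a
    apply le_antisymm
    · refine (h K a).2 ?_
      rintro _ ⟨y, rfl⟩
      have h1 := hΩ K hK a y
      rw [ENNReal.ofReal_le_iff_le_toReal (Ω.place_ne_top _)] at h1
      dsimp only
      linarith [le_abs_self (χ.eval K a - χ.eval K y)]
    · refine ((h K a).1 ⟨a, rfl⟩).trans ?_
      have : (fun i => nndist (a i) (a i)) = 0 := by funext i; simp
      dsimp only
      rw [this, place_zero_eq_zero, Ω.map_zero]
      simp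
  refine ⟨χ', hΔ.logical_equiv χ χ' hχ heq, fun K a b => ?_, heq⟩
  rw [ENNReal.ofReal_le_iff_le_toReal (Ω.place_ne_top _)]
  have key : ∀ a b : ∀ i, K.carrier (Γ i), χ'.eval K a -
      (Ω.toFun (place 0 fun i => nndist (a i) (b i))).toReal ≤ χ'.eval K b := by
    intro a b
    refine (h K b).2 ?_
    rintro _ ⟨y, rfl⟩
    have h1 := (h K a).1 ⟨y, rfl⟩
    have h2 : (Ω.toFun (place 0 fun i => nndist (a i) (y i))).toReal ≤
        (Ω.toFun (place 0 fun i => nndist (a i) (b i))).toReal +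
          (Ω.toFun (place 0 fun i => nndist (b i) (y i))).toReal := by
      rw [← ENNReal.toReal_add (Ω.place_ne_top _) (Ω.place_ne_top _)]
      refine ENNReal.toReal_mono
        (ENNReal.add_ne_top.2 ⟨Ω.place_ne_top _, Ω.place_ne_top _⟩) ?_
      refine le_trans (Ω.mono ?_) (Ω.subadditive _ _)
      rw [← place_add]
      exact place_mono _ fun i => nndist_triangle _ _ _
    dsimp only at h1 ⊢
    linarith
  have h1 := key a b
  have h2 := key b a
  simp only [nndist_comm (b _)] at h2
  exact abs_le.2 ⟨by linarith, by linarith⟩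

/-! ### Variation of a formula in one variable -/

/-- The formula `½ sup_y |θ(y with y_v := x₀) - θ(y with y_v := x₁)|`, measuring how much `θ` can
tell apart two elements substituted for its variable `v`. The factor `½` makes the connective
`1`-Lipschitz. -/
theorem IsDistortionSystem.exists_variation {T : Theory L} {Δ : FormulaSet L}
    (hΔ : IsDistortionSystem.{u, v} T Δ) {n : ℕ} {Γ : Fin n → L.Sorts} (θ : Formula L Γ)
    (hθ : θ ∈ Δ Γ) (w : Fin n) : ∃ E ∈ Δ (fun _ : Fin 2 => Γ w), ∀ (M : Str.{u, v} L)
      (x : Fin 2 → M.carrier (Γ w)), IsLUB (Set.range fun y : ∀ i, M.carrier (Γ i) =>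
        |θ.eval M (Function.update y w (x 0)) - θ.eval M (Function.update y w (x 1))| / 2)
        (E.eval M x) := by
  let B : Fin 2 → L.Sorts := fun _ => Γ w
  have hl := joinCtx_left Γ B
  have hr := joinCtx_right (n := n) Γ B
  let f : Fin 2 → Fin n → Fin (2 + n) := fun e i => if i = w then joinRight n e else joinLeft 2 i
  have hf : ∀ e i, joinCtx Γ B (f e i) = Γ i := by
    intro e i
    by_cases h : i = w
    · simp only [f, h, if_true]; exact hr e
    · simp only [f, h, if_false]; exact hl i
  let F : (ℕ → ℝ) → ℝ := fun r => |r 0 - r 1| / 2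
  have hF : Continuous F := by fun_prop
  let φ : ℕ → Formula L (joinCtx Γ B) := fun j =>
    if j = 0 then θ.rename (f 0) (hf 0) else θ.rename (f 1) (hf 1)
  have hmem : Formula.conn F hF φ ∈ Δ _ := by
    refine hΔ.lipschitz_conn_mem F hF (fun x y ε h => ?_) φ fun j => ?_
    · have h0 := h 0
      have h1 := h 1
      have h2 := abs_abs_sub_abs_le (x 0 - x 1) (y 0 - y 1)
      have h3 : |(x 0 - x 1) - (y 0 - y 1)| ≤ |x 0 - y 0| + |x 1 - y 1| := by
        rw [show (x 0 - x 1) - (y 0 - y 1) = (x 0 - y 0) - (x 1 - y 1) by ring]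
        exact abs_sub _ _
      simp only [F]
      rw [← sub_div, abs_div, abs_two]
      linarith
    · simp only [φ]
      split_ifs
      exacts [hΔ.rename_mem _ _ _ hθ, hΔ.rename_mem _ _ _ hθ]
  refine ⟨(Formula.conn F hF φ).sups, hΔ.sups_mem _ hmem, fun M x => ?_⟩
  have hval : ∀ (y : ∀ i, M.carrier (Γ i)) (e : Fin 2),
      (θ.rename (f e) (hf e)).eval M (joinVal M (k := 2) (Γ := B) y x) =
        θ.eval M (Function.update y w (x e)) := by
    intro y e
    refine θ.eval_rename M _ (hf e) _ _ fun i => ?_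
    by_cases h : i = w
    · subst h
      simp only [f, Function.update_self]
      rw [if_pos rfl]
      exact (joinVal_right M (Γ := B) y x e).symm
    · simp only [f]
      rw [Function.update_of_ne h, if_neg h]
      exact (joinVal_left M (Γ := B) y x i).symm
  have key : ∀ y : ∀ i, M.carrier (Γ i), (Formula.conn F hF φ).eval M (joinVal M y x) =
      |θ.eval M (Function.update y w (x 0)) - θ.eval M (Function.update y w (x 1))| / 2 := by
    intro y
    simp only [Formula.eval, F, φ, if_true, one_ne_zero, if_false]
    rw [hval, hval]
  simpa only [key] using (Formula.conn F hF φ).isLUB_eval_sups M x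

/-! ### Back-and-forth pseudo-metrics -/

section BackForth

variable (Δ : FormulaSet L) (Ω : WeakModulus) (M N : Str.{u, v} L)

theorem backForth_zero (k : ℕ) (p : Fin k → SProd M N) : backForth Δ Ω M N 0 k p =
    ⨆ (ψ : Formula L fun i => (p i).1) (_ : ψ ∈ Δ fun i => (p i).1)
      (_ : ∀ K : Str.{u, v} L, ψ.RespectsAt Ω 0 K), gap p ψ := by
  unfold backForth
  rw [Ordinal.limitRecOn_zero]

theorem backForth_succ (α : Ordinal.{max u v}) (k : ℕ) (p : Fin k → SProd M N) :
    backForth Δ Ω M N (α + 1) k p = max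
      (⨆ (s : L.Sorts) (a : M.carrier s), ⨅ b : N.carrier s,
        backForth Δ Ω M N α (k + 1) (Fin.snoc (α := fun _ => SProd M N) p ⟨s, a, b⟩))
      (⨆ (s : L.Sorts) (b : N.carrier s), ⨅ a : M.carrier s,
        backForth Δ Ω M N α (k + 1) (Fin.snoc (α := fun _ => SProd M N) p ⟨s, a, b⟩)) := by
  unfold backForth
  rw [Ordinal.limitRecOn_add_one]

theorem backForth_limit {l : Ordinal.{max u v}} (hl : Order.IsSuccLimit l) (k : ℕ)
    (p : Fin k → SProd M N) :
    backForth Δ Ω M N l k p = ⨆ (β : Ordinal.{max u v}) (_ : β < l), backForth Δ Ω M N β k p := by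
  unfold backForth
  rw [Ordinal.limitRecOn_limit _ _ _ _ hl]

variable {M N}

theorem backForth_le_backForthInfty (α : Ordinal.{max u v}) {k : ℕ} (p : Fin k → SProd M N) :
    backForth Δ Ω M N α k p ≤ backForthInfty Δ Ω p :=
  le_iSup (fun α => backForth Δ Ω M N α k p) α

theorem gap_le_backForthInfty {k : ℕ} (p : Fin k → SProd M N) (ψ : Formula L fun i => (p i).1)
    (hψ : ψ ∈ Δ fun i => (p i).1) (h : ∀ K : Str.{u, v} L, ψ.RespectsAt Ω 0 K) :
    gap p ψ ≤ backForthInfty Δ Ω p := by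
  refine le_trans ?_ (backForth_le_backForthInfty Δ Ω 0 p)
  rw [backForth_zero]
  exact le_iSup₂_of_le ψ hψ (le_iSup_of_le h le_rfl)

theorem backForth_le_of_snoc {α : Ordinal.{max u v}} {k : ℕ} {p : Fin k → SProd M N} {c : ℝ≥0∞}
    (h₁ : ∀ s (a : M.carrier s), ⨅ b : N.carrier s,
      backForth Δ Ω M N α (k + 1) (Fin.snoc (α := fun _ => SProd M N) p ⟨s, a, b⟩) ≤ c)
    (h₂ : ∀ s (b : N.carrier s), ⨅ a : M.carrier s,
      backForth Δ Ω M N α (k + 1) (Fin.snoc (α := fun _ => SProd M N) p ⟨s, a, b⟩) ≤ c) :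
    backForth Δ Ω M N (α + 1) k p ≤ c := by
  rw [backForth_succ]
  exact max_le (iSup₂_le h₁) (iSup₂_le h₂)

theorem iInf_left_le_backForth_succ (α : Ordinal.{max u v}) {k : ℕ} (p : Fin k → SProd M N)
    (s : L.Sorts) (a : M.carrier s) : ⨅ b : N.carrier s,
      backForth Δ Ω M N α (k + 1) (Fin.snoc (α := fun _ => SProd M N) p ⟨s, a, b⟩) ≤
    backForth Δ Ω M N (α + 1) k p := by
  rw [backForth_succ]
  exact le_max_of_le_left (le_iSup₂_of_le s a le_rfl)

theorem iInf_right_le_backForth_succ (α : Ordinal.{max u v}) {k : ℕ} (p : Fin k → SProd M N)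
    (s : L.Sorts) (b : N.carrier s) : ⨅ a : M.carrier s,
      backForth Δ Ω M N α (k + 1) (Fin.snoc (α := fun _ => SProd M N) p ⟨s, a, b⟩) ≤
    backForth Δ Ω M N (α + 1) k p := by
  rw [backForth_succ]
  exact le_max_of_le_right (le_iSup₂_of_le s b le_rfl)

theorem map_snoc {X Y : Type*} (f : X → Y) {k : ℕ} (q : Fin k → X) (x : X) :
    (fun i => f (Fin.snoc (α := fun _ => X) q x i)) =
      Fin.snoc (α := fun _ => Y) (fun i => f (q i)) (f x) := by
  funext i
  refine Fin.lastCases ?_ (fun j => ?_) i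
  · rw [Fin.snoc_last, Fin.snoc_last]
  · rw [Fin.snoc_castSucc, Fin.snoc_castSucc]

variable (M N) in
/-- Quadruples of elements of one sort, two from `M` and two from `N`. -/
abbrev QuadProd := Σ s : L.Sorts, (M.carrier s × N.carrier s) × (M.carrier s × N.carrier s)

theorem place_snoc_zero_le {X : Type*} {k : ℕ} (f : X → ℝ≥0) (q : Fin k → X) (x : X)
    (hx : f x = 0) : place 0 (fun i => f (Fin.snoc (α := fun _ => X) q x i)) ≤
      place 0 fun i => f (q i) := by
  intro l
  rcases place_cases (k := k + 1) 0 l with ⟨i, rfl⟩ | hl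
  · rw [place_add_apply]
    refine Fin.lastCases ?_ (fun j => ?_) i
    · rw [Fin.snoc_last, hx]
      exact zero_le
    · rw [Fin.snoc_castSucc]
      exact (place_add_apply 0 (fun i => f (q i)) j).ge
  · rw [place_eq_zero _ hl]
    exact zero_le

/-- `r_α` is continuous with modulus `Ω` in each of the two tuples. -/
theorem backForth_le_add_place (α : Ordinal.{max u v}) {k : ℕ} (q : Fin k → QuadProd M N) :
    backForth Δ Ω M N α k (fun i => ⟨(q i).1, (q i).2.1⟩) ≤
      backForth Δ Ω M N α k (fun i => ⟨(q i).1, (q i).2.2⟩) +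
        (Ω.toFun (place 0 fun i => nndist (q i).2.1.1 (q i).2.2.1) +
          Ω.toFun (place 0 fun i => nndist (q i).2.1.2 (q i).2.2.2)) := by
  induction α using Ordinal.limitRecOn generalizing k with
  | zero =>
    rw [backForth_zero]
    refine iSup₂_le fun ψ hψ => iSup_le fun hr => ?_
    have h1 := hr M (fun i => (q i).2.1.1) (fun i => (q i).2.2.1)
    have h2 := hr N (fun i => (q i).2.1.2) (fun i => (q i).2.2.2)
    have h3 : gap (fun i => (⟨(q i).1, (q i).2.2⟩ : SProd M N)) ψ ≤
        backForth Δ Ω M N 0 k (fun i => ⟨(q i).1, (q i).2.2⟩) := by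
      rw [backForth_zero]
      exact le_iSup₂_of_le ψ hψ (le_iSup_of_le hr le_rfl)
    refine le_trans ?_ (add_le_add h3 (add_le_add h1 h2))
    unfold gap
    rw [← ENNReal.ofReal_add (abs_nonneg _) (abs_nonneg _),
      ← ENNReal.ofReal_add (abs_nonneg _) (by positivity)]
    refine ENNReal.ofReal_le_ofReal ?_
    dsimp only
    set A := ψ.eval M fun i => (q i).2.1.1
    set B := ψ.eval N fun i => (q i).2.1.2
    set A' := ψ.eval M fun i => (q i).2.2.1
    set B' := ψ.eval N fun i => (q i).2.2.2
    have e1 := abs_sub_le A A' B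
    have e2 := abs_sub_le A' B' B
    rw [abs_sub_comm B' B] at e2
    linarith
  | add_one α ih =>
    have key : ∀ x : QuadProd M N, x.2.1 = x.2.2 →
        backForth Δ Ω M N α (k + 1) (Fin.snoc (α := fun _ => SProd M N)
          (fun i => ⟨(q i).1, (q i).2.1⟩) ⟨x.1, x.2.1⟩) ≤
        backForth Δ Ω M N α (k + 1) (Fin.snoc (α := fun _ => SProd M N)
          (fun i => ⟨(q i).1, (q i).2.2⟩) ⟨x.1, x.2.2⟩) +
        (Ω.toFun (place 0 fun i => nndist (q i).2.1.1 (q i).2.2.1) +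
          Ω.toFun (place 0 fun i => nndist (q i).2.1.2 (q i).2.2.2)) := by
      intro x hx
      have h := ih (Fin.snoc (α := fun _ => QuadProd M N) q x)
      rw [map_snoc (fun x : QuadProd M N => (⟨x.1, x.2.1⟩ : SProd M N)),
        map_snoc (fun x : QuadProd M N => (⟨x.1, x.2.2⟩ : SProd M N))] at h
      refine h.trans (add_le_add_right (add_le_add (Ω.mono ?_) (Ω.mono ?_)) _)
      · exact place_snoc_zero_le (fun x : QuadProd M N => nndist x.2.1.1 x.2.2.1) q x (by simp [hx])
      · exact place_snoc_zero_le (fun x : QuadProd M N => nndist x.2.1.2 x.2.2.2) q x (by simp [hx])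
    refine backForth_le_of_snoc Δ Ω (fun s a => ?_) fun s b => ?_
    · refine le_trans ?_ (add_le_add_left (iInf_left_le_backForth_succ Δ Ω α _ s a) _)
      rw [ENNReal.iInf_add]
      exact iInf_mono fun b => key ⟨s, (a, b), (a, b)⟩ rfl
    · refine le_trans ?_ (add_le_add_left (iInf_right_le_backForth_succ Δ Ω α _ s b) _)
      rw [ENNReal.iInf_add]
      exact iInf_mono fun a => key ⟨s, (a, b), (a, b)⟩ rfl
  | limit l hl ih =>
    rw [backForth_limit Δ Ω M N hl]
    refine iSup₂_le fun β hβ => (ih β hβ q).trans (add_le_add_left ?_ _)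
    rw [backForth_limit Δ Ω M N hl]
    exact le_iSup₂_of_le β hβ le_rfl

theorem backForth_snoc_le (α : Ordinal.{max u v}) {k : ℕ} (p : Fin k → SProd M N) (s : L.Sorts)
    (a a' : M.carrier s) (b b' : N.carrier s) :
    backForth Δ Ω M N α (k + 1) (Fin.snoc (α := fun _ => SProd M N) p ⟨s, a, b⟩) ≤
      backForth Δ Ω M N α (k + 1) (Fin.snoc (α := fun _ => SProd M N) p ⟨s, a', b'⟩) +
        (Ω.toFun (Pi.single k (nndist a a')) + Ω.toFun (Pi.single k (nndist b b'))) := by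
  have h := backForth_le_add_place Δ Ω α (Fin.snoc (α := fun _ => QuadProd M N)
    (fun i => (⟨(p i).1, (p i).2, (p i).2⟩ : QuadProd M N)) ⟨s, (a, b), (a', b')⟩)
  rw [map_snoc (fun x : QuadProd M N => (⟨x.1, x.2.1⟩ : SProd M N)),
    map_snoc (fun x : QuadProd M N => (⟨x.1, x.2.2⟩ : SProd M N))] at h
  have key : ∀ f : QuadProd M N → ℝ≥0, (∀ x, x.2.1 = x.2.2 → f x = 0) → ∀ y,
      place 0 (fun i => f (Fin.snoc (α := fun _ => QuadProd M N)
        (fun i => (⟨(p i).1, (p i).2, (p i).2⟩ : QuadProd M N)) y i)) ≤ Pi.single k (f y) := by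
    intro f hf y l
    rcases place_cases (k := k + 1) 0 l with ⟨i, rfl⟩ | hl
    · rw [place_add_apply]
      refine Fin.lastCases ?_ (fun j => ?_) i
      · rw [Fin.snoc_last]
        simp
      · rw [Fin.snoc_castSucc, hf _ rfl]
        exact zero_le
    · rw [place_eq_zero _ hl]
      exact zero_le
  refine h.trans (add_le_add_right (add_le_add (Ω.mono ?_) (Ω.mono ?_)) _)
  · exact key (fun x => nndist x.2.1.1 x.2.2.1) (fun x hx => by simp [hx]) _
  · exact key (fun x => nndist x.2.1.2 x.2.2.2) (fun x hx => by simp [hx]) _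

theorem WeakModulus.exists_pos_single_lt {Ω : WeakModulus} (k : ℕ) {c : ℝ≥0∞} (hc : 0 < c) :
    ∃ δ : ℝ, 0 < δ ∧ ∀ {X : Type v} [MetricSpace X] (x y : X), dist x y < δ →
      Ω.toFun (Pi.single k (nndist x y)) < c := by
  obtain ⟨δ, hδ, h⟩ := Metric.eventually_nhds_iff.1
    ((Ω.tendsto_single k).eventually_lt_const hc)
  refine ⟨δ, hδ, fun x y hxy => h ?_⟩
  rw [NNReal.dist_eq, NNReal.coe_zero, sub_zero, NNReal.abs_eq]
  exact hxy

theorem gap_le_dis {R : Set (SProd M N)} {k : ℕ} (p : Fin k → SProd M N) (hp : ∀ i, p i ∈ R)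
    (φ : Formula L fun i => (p i).1) (hφ : φ ∈ Δ fun i => (p i).1) : gap p φ ≤ dis Δ R :=
  le_iSup₂_of_le k p <| le_iSup₂_of_le hp φ <| le_iSup_of_le hφ le_rfl

theorem dis_le {R : Set (SProd M N)} {c : ℝ≥0∞} (h : ∀ (k : ℕ) (p : Fin k → SProd M N),
    (∀ i, p i ∈ R) → ∀ φ ∈ Δ (fun i => (p i).1), gap p φ ≤ c) : dis Δ R ≤ c :=
  iSup₂_le fun k p => iSup₂_le fun hp φ => iSup_le fun hφ => h k p hp φ hφ

/-- An almost correlation is a winning strategy in the back-and-forth game: elements outside its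
domain are handled by approximation, using the continuity of `r_α`. -/
theorem backForth_le_dis {R : Set (SProd M N)} (hR : IsAlmostCorrelation R)
    (α : Ordinal.{max u v}) {k : ℕ} (p : Fin k → SProd M N) (hp : ∀ i, p i ∈ R) :
    backForth Δ Ω M N α k p ≤ dis Δ R := by
  obtain ⟨A, B, hA, hB, hAB⟩ := hR
  induction α using Ordinal.limitRecOn generalizing k with
  | zero =>
    rw [backForth_zero]
    exact iSup₂_le fun ψ hψ => iSup_le fun _ => gap_le_dis Δ p hp ψ hψ
  | add_one α ih =>
    have hsnoc : ∀ x ∈ R, ∀ i, (Fin.snoc (α := fun _ => SProd M N) p x : _ → _) i ∈ R := by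
      intro x hx i
      refine Fin.lastCases ?_ (fun j => ?_) i
      · rwa [Fin.snoc_last]
      · rw [Fin.snoc_castSucc]; exact hp j
    refine backForth_le_of_snoc Δ Ω (fun s a => ?_) fun s b => ?_
    · refine ENNReal.le_of_forall_pos_le_add fun ε hε _ => ?_
      obtain ⟨δ, hδ, h⟩ := WeakModulus.exists_pos_single_lt (Ω := Ω) k (ENNReal.coe_pos.2 hε)
      obtain ⟨a', ha', hd⟩ := (hA.1 s).exists_dist_lt a hδ
      obtain ⟨b, hb⟩ := hAB.2.1 s a' ha'
      refine (iInf_le _ b).trans ((backForth_snoc_le Δ Ω α p s a a' b b).trans ?_)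
      refine add_le_add (ih _ (hsnoc _ hb)) ?_
      rw [nndist_self, Pi.single_zero, Ω.map_zero, add_zero]
      exact (h a a' hd).le
    · refine ENNReal.le_of_forall_pos_le_add fun ε hε _ => ?_
      obtain ⟨δ, hδ, h⟩ := WeakModulus.exists_pos_single_lt (Ω := Ω) k (ENNReal.coe_pos.2 hε)
      obtain ⟨b', hb', hd⟩ := (hB.1 s).exists_dist_lt b hδ
      obtain ⟨a, ha⟩ := hAB.2.2 s b' hb'
      refine (iInf_le _ a).trans ((backForth_snoc_le Δ Ω α p s a a b b').trans ?_)
      refine add_le_add (ih _ (hsnoc _ ha)) ?_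
      rw [nndist_self, Pi.single_zero, Ω.map_zero, zero_add]
      exact (h b b' hd).le
  | limit l hl ih =>
    rw [backForth_limit Δ Ω M N hl]
    exact iSup₂_le fun β hβ => ih β hβ p hp

theorem backForthInfty_le_almostRho {k : ℕ} (p : Fin k → SProd M N) :
    backForthInfty Δ Ω p ≤ almostRho Δ p :=
  iSup_le fun α => le_iInf₂ fun _ hR => le_iInf fun hp => backForth_le_dis Δ Ω hR α p hp

theorem isDenseSub_univ (M : Str.{u, v} L) : IsDenseSub M fun _ => Set.univ :=
  ⟨fun _ => dense_univ, fun _ _ _ => Set.mem_univ _⟩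

theorem IsCorrelation.isAlmostCorrelation {R : Set (SProd M N)} (hR : IsCorrelation R) :
    IsAlmostCorrelation R :=
  ⟨_, _, isDenseSub_univ M, isDenseSub_univ N, hR⟩

theorem almostRho_le_rho {k : ℕ} (p : Fin k → SProd M N) : almostRho Δ p ≤ rho Δ p :=
  le_iInf₂ fun R hR => le_iInf fun hp =>
    iInf₂_le_of_le R hR.isAlmostCorrelation (iInf_le_of_le hp le_rfl)

theorem backForthInfty_le_rho {k : ℕ} (p : Fin k → SProd M N) :
    backForthInfty Δ Ω p ≤ rho Δ p :=
  (backForthInfty_le_almostRho Δ Ω p).trans (almostRho_le_rho Δ p)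

variable (M N) in
/-- Triples of elements of one sort from three structures. -/
abbrev TripleProd (K : Str.{u, v} L) :=
  Σ s : L.Sorts, M.carrier s × N.carrier s × K.carrier s

theorem backForth_triangle {K : Str.{u, v} L} (α : Ordinal.{max u v}) {k : ℕ}
    (q : Fin k → TripleProd M N K) :
    backForth Δ Ω M K α k (fun i => ⟨(q i).1, (q i).2.1, (q i).2.2.2⟩) ≤
      backForth Δ Ω M N α k (fun i => ⟨(q i).1, (q i).2.1, (q i).2.2.1⟩) +
        backForth Δ Ω N K α k (fun i => ⟨(q i).1, (q i).2.2⟩) := by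
  induction α using Ordinal.limitRecOn generalizing k with
  | zero =>
    rw [backForth_zero]
    refine iSup₂_le fun ψ hψ => iSup_le fun hr => ?_
    have h1 : gap (fun i => (⟨(q i).1, (q i).2.1, (q i).2.2.1⟩ : SProd M N)) ψ ≤
        backForth Δ Ω M N 0 k (fun i => ⟨(q i).1, (q i).2.1, (q i).2.2.1⟩) := by
      rw [backForth_zero]
      exact le_iSup₂_of_le ψ hψ (le_iSup_of_le hr le_rfl)
    have h2 : gap (fun i => (⟨(q i).1, (q i).2.2⟩ : SProd N K)) ψ ≤
        backForth Δ Ω N K 0 k (fun i => ⟨(q i).1, (q i).2.2⟩) := by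
      rw [backForth_zero]
      exact le_iSup₂_of_le ψ hψ (le_iSup_of_le hr le_rfl)
    refine le_trans ?_ (add_le_add h1 h2)
    unfold gap
    rw [← ENNReal.ofReal_add (abs_nonneg _) (abs_nonneg _)]
    exact ENNReal.ofReal_le_ofReal (abs_sub_le _ _ _)
  | add_one α ih =>
    have key : ∀ x : TripleProd M N K,
        backForth Δ Ω M K α (k + 1) (Fin.snoc (α := fun _ => SProd M K)
          (fun i => ⟨(q i).1, (q i).2.1, (q i).2.2.2⟩) ⟨x.1, x.2.1, x.2.2.2⟩) ≤
        backForth Δ Ω M N α (k + 1) (Fin.snoc (α := fun _ => SProd M N)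
          (fun i => ⟨(q i).1, (q i).2.1, (q i).2.2.1⟩) ⟨x.1, x.2.1, x.2.2.1⟩) +
        backForth Δ Ω N K α (k + 1) (Fin.snoc (α := fun _ => SProd N K)
          (fun i => ⟨(q i).1, (q i).2.2⟩) ⟨x.1, x.2.2⟩) := by
      intro x
      have h := ih (Fin.snoc (α := fun _ => TripleProd M N K) q x)
      rwa [map_snoc (fun x : TripleProd M N K => (⟨x.1, x.2.1, x.2.2.2⟩ : SProd M K)),
        map_snoc (fun x : TripleProd M N K => (⟨x.1, x.2.1, x.2.2.1⟩ : SProd M N)),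
        map_snoc (fun x : TripleProd M N K => (⟨x.1, x.2.2⟩ : SProd N K))] at h
    refine backForth_le_of_snoc Δ Ω (fun s a => ?_) fun s c => ?_
    · refine le_trans ?_ (add_le_add_left (iInf_left_le_backForth_succ Δ Ω α _ s a) _)
      rw [ENNReal.iInf_add]
      refine le_iInf fun b => le_trans ?_
        (add_le_add_right (iInf_left_le_backForth_succ Δ Ω α _ s b) _)
      rw [ENNReal.add_iInf]
      exact iInf_mono fun c => key ⟨s, a, b, c⟩
    · refine le_trans ?_ (add_le_add_right (iInf_right_le_backForth_succ Δ Ω α _ s c) _)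
      rw [ENNReal.add_iInf]
      refine le_iInf fun b => le_trans ?_
        (add_le_add_left (iInf_right_le_backForth_succ Δ Ω α _ s b) _)
      rw [ENNReal.iInf_add]
      exact iInf_mono fun a => key ⟨s, a, b, c⟩
  | limit l hl ih =>
    rw [backForth_limit Δ Ω M K hl]
    refine iSup₂_le fun β hβ => (ih β hβ q).trans (add_le_add ?_ ?_)
    · rw [backForth_limit Δ Ω M N hl]
      exact le_iSup₂_of_le β hβ le_rfl
    · rw [backForth_limit Δ Ω N K hl]
      exact le_iSup₂_of_le β hβ le_rfl

theorem backForthInfty_triangle {K : Str.{u, v} L} {k : ℕ} {Γ : Fin k → L.Sorts}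
    (m : ∀ i, M.carrier (Γ i)) (n : ∀ i, N.carrier (Γ i)) (c : ∀ i, K.carrier (Γ i)) :
    backForthInfty Δ Ω (pairs m c) ≤
      backForthInfty Δ Ω (pairs m n) + backForthInfty Δ Ω (pairs n c) :=
  iSup_le fun α => (backForth_triangle Δ Ω α fun i => ⟨Γ i, m i, n i, c i⟩).trans <|
    add_le_add (backForth_le_backForthInfty Δ Ω α _) (backForth_le_backForthInfty Δ Ω α _)

/-- The pair in the opposite order. -/
def swapPair (x : SProd M N) : SProd N M := ⟨x.1, x.2.2, x.2.1⟩

theorem dis_preimage_swap_le (R : Set (SProd M N)) : dis Δ (swapPair ⁻¹' R) ≤ dis Δ R := by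
  refine dis_le Δ fun k p hp φ hφ => ?_
  refine le_trans ?_ (gap_le_dis Δ (fun i => swapPair (p i)) hp φ hφ)
  unfold gap
  rw [abs_sub_comm]
  rfl

theorem rho_comm_le {k : ℕ} {Γ : Fin k → L.Sorts} (m : ∀ i, M.carrier (Γ i))
    (n : ∀ i, N.carrier (Γ i)) : rho Δ (pairs n m) ≤ rho Δ (pairs m n) := by
  refine le_iInf₂ fun R hR => le_iInf fun hp => ?_
  refine iInf₂_le_of_le (swapPair ⁻¹' R) ⟨fun _ _ => ⟨trivial, trivial⟩, ?_, ?_⟩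
    (iInf_le_of_le hp (dis_preimage_swap_le Δ R))
  · exact hR.2.2
  · exact hR.2.1

/-- The pseudo-metric `r_∞` is `2`-Lipschitz in `ρ_Δ`, by the triangle inequality. -/
theorem backForthInfty_le_add_rho {M' N' : Str.{u, v} L} {k : ℕ} {Γ : Fin k → L.Sorts}
    (m : ∀ i, M.carrier (Γ i)) (n : ∀ i, N.carrier (Γ i)) (m' : ∀ i, M'.carrier (Γ i))
    (n' : ∀ i, N'.carrier (Γ i)) : backForthInfty Δ Ω (pairs m n) ≤
      backForthInfty Δ Ω (pairs m' n') + 2 * max (rho Δ (pairs m m')) (rho Δ (pairs n n')) := by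
  have h1 := backForthInfty_triangle Δ Ω m m' n
  have h2 := backForthInfty_triangle Δ Ω m' n' n
  have h3 := backForthInfty_le_rho Δ Ω (pairs m m')
  have h4 := (backForthInfty_le_rho Δ Ω (pairs n' n)).trans (rho_comm_le Δ n n')
  calc backForthInfty Δ Ω (pairs m n)
      ≤ backForthInfty Δ Ω (pairs m m') +
        (backForthInfty Δ Ω (pairs m' n') + backForthInfty Δ Ω (pairs n' n)) :=
        h1.trans (add_le_add_right h2 _)
    _ = backForthInfty Δ Ω (pairs m' n') +
        (backForthInfty Δ Ω (pairs m m') + backForthInfty Δ Ω (pairs n' n)) := by ring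
    _ ≤ _ := by
      rw [two_mul]
      exact add_le_add_right (add_le_add (h3.trans (le_max_left _ _))
        (h4.trans (le_max_right _ _))) _

/-! ### Stabilization of the back-and-forth hierarchy -/

theorem backForth_succ_mono {α β : Ordinal.{max u v}}
    (h : ∀ k p, backForth Δ Ω M N α k p ≤ backForth Δ Ω M N β k p) (k : ℕ)
    (p : Fin k → SProd M N) :
    backForth Δ Ω M N (α + 1) k p ≤ backForth Δ Ω M N (β + 1) k p := by
  rw [backForth_succ, backForth_succ]
  exact max_le_max (iSup₂_mono fun s a => iInf_mono fun b => h _ _)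
    (iSup₂_mono fun s b => iInf_mono fun a => h _ _)

theorem nndist_congr {K : Str.{u, v} L} {s s' : L.Sorts} (h : s' = s) {x y : K.carrier s}
    {x' y' : K.carrier s'} (hx : x ≍ x') (hy : y ≍ y') : nndist x y = nndist x' y' := by
  subst h
  rw [eq_of_heq hx, eq_of_heq hy]

theorem IsDistortionSystem.backForth_zero_le_snoc {T : Theory L} {Δ : FormulaSet L}
    (hΔ : IsDistortionSystem.{u, v} T Δ) {k : ℕ} (p : Fin k → SProd M N) (x : SProd M N) :
    backForth Δ Ω M N 0 k p ≤
      backForth Δ Ω M N 0 (k + 1) (Fin.snoc (α := fun _ => SProd M N) p x) := by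
  rw [backForth_zero]
  refine iSup₂_le fun ψ hψ => iSup_le fun hr => ?_
  set p' : Fin (k + 1) → SProd M N := Fin.snoc (α := fun _ => SProd M N) p x with hp'
  have e : ∀ i : Fin k, p' i.castSucc = p i :=
    fun i => Fin.snoc_castSucc (α := fun _ => SProd M N) x p i
  have hs : ∀ i : Fin k, (p' i.castSucc).1 = (p i).1 := fun i => by rw [e]
  have hev : ∀ (K : Str.{u, v} L) (a : ∀ i, K.carrier (p' i).1),
      ∃ a' : ∀ i, K.carrier (p i).1, (∀ i, a' i ≍ a i.castSucc) ∧
        (ψ.rename (Γ' := fun i => (p' i).1) Fin.castSucc hs).eval K a = ψ.eval K a' := by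
    intro K a
    have ha : ∀ i, cast (congrArg K.carrier (hs i)) (a i.castSucc) ≍ a i.castSucc :=
      fun i => cast_heq _ _
    exact ⟨_, ha, ψ.eval_rename K _ _ _ _ ha⟩
  have hgap : gap p' (ψ.rename Fin.castSucc hs) = gap p ψ := by
    unfold gap
    rw [ψ.eval_rename M Fin.castSucc hs _ (fun i => (p i).2.1) fun i => by rw [e],
      ψ.eval_rename N Fin.castSucc hs _ (fun i => (p i).2.2) fun i => by rw [e]]
  rw [← hgap, backForth_zero]
  refine le_iSup₂_of_le _ (hΔ.rename_mem Fin.castSucc hs ψ hψ) (le_iSup_of_le ?_ le_rfl)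
  intro K a b
  obtain ⟨a', ha', ea⟩ := hev K a
  obtain ⟨b', hb', eb⟩ := hev K b
  rw [ea, eb]
  refine (hr K a' b').trans (Ω.mono fun l => ?_)
  rcases place_cases (k := k) 0 l with ⟨i, rfl⟩ | hl
  · rw [place_add_apply, zero_add]
    refine le_trans (le_of_eq ?_) (place_zero_apply (k := k + 1) _ i.castSucc).ge
    exact nndist_congr (hs i) (ha' i) (hb' i)
  · rw [place_eq_zero _ hl]
    exact zero_le

theorem IsDistortionSystem.backForth_mono [Nonempty L.Sorts] {T : Theory L} {Δ : FormulaSet L}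
    (hΔ : IsDistortionSystem.{u, v} T Δ) {α β : Ordinal.{max u v}} (hαβ : α ≤ β) :
    ∀ k p, backForth Δ Ω M N α k p ≤ backForth Δ Ω M N β k p := by
  have hsucc : ∀ (α : Ordinal.{max u v}) k p,
      backForth Δ Ω M N α k p ≤ backForth Δ Ω M N (α + 1) k p := by
    intro α
    induction α using Ordinal.limitRecOn with
    | zero =>
      intro k p
      obtain ⟨s⟩ := ‹Nonempty L.Sorts›
      obtain ⟨a⟩ := M.nonempty s
      refine le_trans (le_iInf fun b => ?_) (iInf_left_le_backForth_succ Δ Ω 0 p s a)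
      exact hΔ.backForth_zero_le_snoc Ω p _
    | add_one α ih => exact backForth_succ_mono Δ Ω ih
    | limit l hl ih =>
      intro k p
      rw [backForth_limit Δ Ω M N hl]
      refine iSup₂_le fun β hβ => (ih β hβ k p).trans (backForth_succ_mono Δ Ω ?_ k p)
      intro k p
      rw [backForth_limit Δ Ω M N hl]
      exact le_iSup₂_of_le β hβ le_rfl
  induction β using Ordinal.limitRecOn with
  | zero =>
    intro k p
    rw [nonpos_iff_eq_zero.1 hαβ]
  | add_one β ih =>
    intro k p
    rcases hαβ.lt_or_eq with h | rfl
    · exact (ih (Order.lt_add_one_iff.1 h) k p).trans (hsucc β k p)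
    · exact le_rfl
  | limit l hl ih =>
    intro k p
    rcases hαβ.lt_or_eq with h | rfl
    · rw [backForth_limit Δ Ω M N hl]
      exact le_iSup₂_of_le α h le_rfl
    · exact le_rfl

/-- There are too few functions on tuples for the hierarchy to grow forever, so that
`r_∞ = r_α = r_{α+1}` for some ordinal `α`. -/
theorem IsDistortionSystem.exists_stable [Nonempty L.Sorts] {T : Theory L} {Δ : FormulaSet L}
    (hΔ : IsDistortionSystem.{u, v} T Δ) (M N : Str.{u, v} L) : ∃ α : Ordinal.{max u v},
      (∀ k (p : Fin k → SProd M N), backForthInfty Δ Ω p = backForth Δ Ω M N α k p) ∧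
      ∀ k (p : Fin k → SProd M N), backForthInfty Δ Ω p = backForth Δ Ω M N (α + 1) k p := by
  let f : Ordinal.{max u v} → (Σ k : ℕ, Fin k → SProd M N) → ℝ≥0∞ :=
    fun α x => backForth Δ Ω M N α x.1 x.2
  have hf : ¬ Function.Injective f := not_injective_of_ordinal f
  obtain ⟨α, β, hαβ, hlt⟩ : ∃ α β, f α = f β ∧ α < β := by
    simp only [Function.Injective, not_forall] at hf
    obtain ⟨α, β, h, hne⟩ := hf
    rcases lt_or_gt_of_ne hne with h' | h'
    exacts [⟨α, β, h, h'⟩, ⟨β, α, h.symm, h'⟩]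
  have hα : ∀ k p, backForth Δ Ω M N (α + 1) k p ≤ backForth Δ Ω M N α k p := by
    intro k p
    refine (hΔ.backForth_mono Ω (Order.add_one_le_of_lt hlt) k p).trans ?_
    exact (congrFun hαβ ⟨k, p⟩).ge
  have hall : ∀ γ k p, backForth Δ Ω M N γ k p ≤ backForth Δ Ω M N α k p := by
    intro γ
    induction γ using Ordinal.limitRecOn with
    | zero => exact hΔ.backForth_mono Ω zero_le
    | add_one γ ih => exact fun k p => (backForth_succ_mono Δ Ω ih k p).trans (hα k p)
    | limit l hl ih =>
      intro k p
      rw [backForth_limit Δ Ω M N hl]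
      exact iSup₂_le fun β hβ => ih β hβ k p
  have h1 : ∀ k (p : Fin k → SProd M N), backForthInfty Δ Ω p = backForth Δ Ω M N α k p :=
    fun k p => le_antisymm (iSup_le fun γ => hall γ k p) (backForth_le_backForthInfty Δ Ω α p)
  refine ⟨α, h1, fun k p => (h1 k p).trans (le_antisymm ?_ (hα k p))⟩
  exact hΔ.backForth_mono Ω le_self_add k p

/-- If `r_∞(p) < t`, an element of `M` has a partner in a given dense subset of `N` preserving
this. -/
theorem IsDistortionSystem.exists_right [Nonempty L.Sorts] {T : Theory L} {Δ : FormulaSet L}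
    (hΔ : IsDistortionSystem.{u, v} T Δ) {k : ℕ} {p : Fin k → SProd M N} {t : ℝ≥0∞}
    (hp : backForthInfty Δ Ω p < t) {s : L.Sorts} (a : M.carrier s) {B : Set (N.carrier s)}
    (hB : Dense B) :
    ∃ b ∈ B, backForthInfty Δ Ω (Fin.snoc (α := fun _ => SProd M N) p ⟨s, a, b⟩) < t := by
  obtain ⟨α, h1, h2⟩ := hΔ.exists_stable Ω M N
  rw [h2] at hp
  obtain ⟨b, hb⟩ := iInf_lt_iff.1
    ((iInf_left_le_backForth_succ Δ Ω α p s a).trans_lt hp)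
  obtain ⟨δ, hδ, h⟩ := WeakModulus.exists_pos_single_lt (Ω := Ω) k (tsub_pos_of_lt hb)
  obtain ⟨b', hb', hd⟩ := hB.exists_dist_lt b hδ
  refine ⟨b', hb', ?_⟩
  rw [h1]
  refine (backForth_snoc_le Δ Ω α p s a a b' b).trans_lt ?_
  rw [nndist_self, Pi.single_zero, Ω.map_zero, zero_add, nndist_comm, add_comm]
  exact lt_tsub_iff_right.1 (h b b' hd)

theorem IsDistortionSystem.exists_left [Nonempty L.Sorts] {T : Theory L} {Δ : FormulaSet L}
    (hΔ : IsDistortionSystem.{u, v} T Δ) {k : ℕ} {p : Fin k → SProd M N} {t : ℝ≥0∞}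
    (hp : backForthInfty Δ Ω p < t) {s : L.Sorts} (b : N.carrier s) {A : Set (M.carrier s)}
    (hA : Dense A) :
    ∃ a ∈ A, backForthInfty Δ Ω (Fin.snoc (α := fun _ => SProd M N) p ⟨s, a, b⟩) < t := by
  obtain ⟨α, h1, h2⟩ := hΔ.exists_stable Ω M N
  rw [h2] at hp
  obtain ⟨a, ha⟩ := iInf_lt_iff.1
    ((iInf_right_le_backForth_succ Δ Ω α p s b).trans_lt hp)
  obtain ⟨δ, hδ, h⟩ := WeakModulus.exists_pos_single_lt (Ω := Ω) k (tsub_pos_of_lt ha)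
  obtain ⟨a', ha', hd⟩ := hA.exists_dist_lt a hδ
  refine ⟨a', ha', ?_⟩
  rw [h1]
  refine (backForth_snoc_le Δ Ω α p s a' a b b).trans_lt ?_
  rw [nndist_self, Pi.single_zero, Ω.map_zero, add_zero, nndist_comm, add_comm]
  exact lt_tsub_iff_right.1 (h a a' hd)

end BackForth

/-! ### Countable dense substructures -/

/-- The set `G` together with all values of function symbols at arguments from `G`. -/
def fnStep (M : Str.{u, v} L) (G : Set (Σ s, M.carrier s)) : Set (Σ s, M.carrier s) :=
  G ∪ ⋃ f : L.Fn, Set.range fun a : ∀ i, {x : M.carrier (L.fnDom f i) // ⟨_, x⟩ ∈ G} =>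
    (⟨L.fnCod f, M.fn f fun i => (a i).1⟩ : Σ s, M.carrier s)

theorem countable_fnStep (hL : L.IsCountable) (M : Str.{u, v} L) {G : Set (Σ s, M.carrier s)}
    (hG : G.Countable) : (fnStep M G).Countable := by
  have := hL.2.1
  refine hG.union (Set.countable_iUnion fun f => ?_)
  have : ∀ s, Countable {x : M.carrier s // (⟨s, x⟩ : Σ s, M.carrier s) ∈ G} := by
    intro s
    have := hG.to_subtype
    refine Function.Injective.countable (β := G) (f := fun x => ⟨⟨s, x.1⟩, x.2⟩) ?_
    rintro ⟨x, hx⟩ ⟨y, hy⟩ h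
    simpa using h
  exact Set.countable_range _

/-- In a separable structure for a countable language, finitely many elements lie in a countable
dense substructure. -/
theorem exists_countable_isDenseSub (hL : L.IsCountable) {M : Str.{u, v} L} (hM : M.IsSeparable)
    {k : ℕ} {Γ : Fin k → L.Sorts} (m : ∀ i, M.carrier (Γ i)) :
    ∃ A : ∀ s, Set (M.carrier s), IsDenseSub M A ∧ Countable (Σ s, A s) ∧ ∀ i, m i ∈ A (Γ i) := by
  have := hL.1
  have hd : ∀ s, ∃ D : Set (M.carrier s), D.Countable ∧ Dense D := fun s => by
    have := hM s
    exact TopologicalSpace.exists_countable_dense _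
  choose D hDc hDd using hd
  let G₀ : Set (Σ s, M.carrier s) :=
    (⋃ s, (fun x => (⟨s, x⟩ : Σ s, M.carrier s)) '' D s) ∪ Set.range fun i => ⟨Γ i, m i⟩
  have hG₀ : G₀.Countable :=
    (Set.countable_iUnion fun s => (hDc s).image _).union (Set.countable_range _)
  let G : ℕ → Set (Σ s, M.carrier s) := fun n => (fnStep M)^[n] G₀
  have hG : ∀ n, (G n).Countable := by
    intro n
    induction n with
    | zero => exact hG₀
    | succ n ih =>
      simp only [G, Function.iterate_succ_apply'] at ih ⊢
      exact countable_fnStep hL M ih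
  have hmono : Monotone G := by
    refine monotone_nat_of_le_succ fun n => ?_
    simp only [G, Function.iterate_succ_apply']
    exact Set.subset_union_left
  have hU : (⋃ n, G n).Countable := Set.countable_iUnion hG
  refine ⟨fun s => {x | ⟨s, x⟩ ∈ ⋃ n, G n}, ⟨fun s => ?_, fun f a ha => ?_⟩, ?_, fun i => ?_⟩
  · refine (hDd s).mono fun x hx => Set.mem_iUnion.2 ⟨0, .inl ?_⟩
    exact Set.mem_iUnion.2 ⟨s, x, hx, rfl⟩
  · choose n hn using fun i => Set.mem_iUnion.1 (ha i)
    refine Set.mem_iUnion.2 ⟨Finset.univ.sup n + 1, ?_⟩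
    simp only [G, Function.iterate_succ_apply']
    refine .inr (Set.mem_iUnion.2 ⟨f, fun i => ⟨a i, ?_⟩, rfl⟩)
    exact hmono (Finset.le_sup (Finset.mem_univ i)) (hn i)
  · have := hU.to_subtype
    refine Function.Injective.countable (β := ⋃ n, G n) (f := fun x => ⟨⟨x.1, x.2.1⟩, x.2.2⟩) ?_
    rintro ⟨s, x, hx⟩ ⟨s', y, hy⟩ h
    simp only [Subtype.mk.injEq, Sigma.mk.injEq] at h
    obtain ⟨rfl, h⟩ := h
    cases h
    rfl
  · exact Set.mem_iUnion.2 ⟨0, .inr ⟨i, rfl⟩⟩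

/-! ### Infinite plays of the back-and-forth game -/

/-- The sequence whose `n`-th term is the value of `g` at its first `n` terms. -/
def seqOf {X : Type*} (g : ∀ n, (Fin n → X) → X) : ℕ → X
  | n => g n fun i => seqOf g i
decreasing_by exact i.2

theorem seqOf_eq {X : Type*} (g : ∀ n, (Fin n → X) → X) (n : ℕ) :
    seqOf g n = g n fun i => seqOf g i := by
  rw [seqOf]

theorem prefix_succ {X : Type*} (p : ℕ → X) (n : ℕ) : (fun i : Fin (n + 1) => p i) =
    Fin.snoc (α := fun _ => X) (fun i : Fin n => p i) (p n) := by
  funext i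
  refine Fin.lastCases ?_ (fun j => ?_) i
  · rw [Fin.snoc_last]; rfl
  · rw [Fin.snoc_castSucc]; rfl

/-- Every nonempty countable type has an enumeration attaining each value infinitely often. -/
theorem exists_enumeration_frequently (X : Type*) [Countable X] [Nonempty X] :
    ∃ e : ℕ → X, ∀ x n, ∃ i, n ≤ i ∧ e i = x := by
  obtain ⟨f, hf⟩ := exists_surjective_nat X
  refine ⟨fun i => f i.unpair.1, fun x n => ?_⟩
  obtain ⟨j, rfl⟩ := hf x
  exact ⟨Nat.pair j n, Nat.right_le_pair j n, by simp⟩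

/-- Given countable dense sets `A`, `B` of elements of `M` and `N`, a play of the back-and-forth
game starting with `p₀` in which all elements of `A` and `B` are played infinitely often. -/
theorem IsDistortionSystem.exists_play [Nonempty L.Sorts] {T : Theory L} {Δ : FormulaSet L}
    (hΔ : IsDistortionSystem.{u, v} T Δ) (Ω : WeakModulus) {M N : Str.{u, v} L}
    {A : ∀ s, Set (M.carrier s)} {B : ∀ s, Set (N.carrier s)} (hA : ∀ s, Dense (A s))
    (hB : ∀ s, Dense (B s)) (hAc : Countable (Σ s, A s)) (hBc : Countable (Σ s, B s)) {k : ℕ}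
    (p₀ : Fin k → SProd M N) (hp₀ : ∀ i, (p₀ i).2.1 ∈ A (p₀ i).1 ∧ (p₀ i).2.2 ∈ B (p₀ i).1)
    {t : ℝ≥0∞} (ht : backForthInfty Δ Ω p₀ < t) :
    ∃ p : ℕ → SProd M N, (∀ i : Fin k, p i = p₀ i) ∧
      (∀ n, k ≤ n → backForthInfty Δ Ω (fun i : Fin n => p i) < t) ∧
      (∀ i, (p i).2.1 ∈ A (p i).1 ∧ (p i).2.2 ∈ B (p i).1) ∧
      (∀ s, ∀ a ∈ A s, ∀ n, ∃ i, n ≤ i ∧ ∃ b, p i = ⟨s, a, b⟩) ∧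
      (∀ s, ∀ b ∈ B s, ∀ n, ∃ i, n ≤ i ∧ ∃ a, p i = ⟨s, a, b⟩) := by
  have hne : Nonempty ((Σ s, A s) ⊕ Σ s, B s) := by
    obtain ⟨s⟩ := ‹Nonempty L.Sorts›
    obtain ⟨a, ha⟩ := (hA s).nonempty
    exact ⟨.inl ⟨s, a, ha⟩⟩
  obtain ⟨e, he⟩ := exists_enumeration_frequently ((Σ s, A s) ⊕ Σ s, B s)
  let Good : SProd M N → Prop := fun x => x.2.1 ∈ A x.1 ∧ x.2.2 ∈ B x.1
  let Match : ((Σ s, A s) ⊕ Σ s, B s) → SProd M N → Prop := fun c x =>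
    Sum.elim (fun y : Σ s, A s => ∃ b, x = ⟨y.1, y.2, b⟩)
      (fun y : Σ s, B s => ∃ a, x = ⟨y.1, a, y.2⟩) c
  have hstep : ∀ (n : ℕ) (q : Fin n → SProd M N), ∃ x : SProd M N,
      (∀ h : n < k, x = p₀ ⟨n, h⟩) ∧ (k ≤ n → backForthInfty Δ Ω q < t →
        backForthInfty Δ Ω (Fin.snoc (α := fun _ => SProd M N) q x) < t ∧ Good x ∧
          Match (e n) x) := by
    intro n q
    by_cases hn : n < k
    · exact ⟨p₀ ⟨n, hn⟩, fun _ => rfl, fun h => absurd hn h.not_gt⟩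
    by_cases hq : backForthInfty Δ Ω q < t
    · rcases h : e n with ⟨s, a, ha⟩ | ⟨s, b, hb⟩
      · obtain ⟨b, hb, h⟩ := hΔ.exists_right Ω hq a (hB s)
        exact ⟨⟨s, a, b⟩, fun h => absurd h hn, fun _ _ => ⟨h, ⟨ha, hb⟩, b, rfl⟩⟩
      · obtain ⟨a, ha, h⟩ := hΔ.exists_left Ω hq b (hA s)
        exact ⟨⟨s, a, b⟩, fun h => absurd h hn, fun _ _ => ⟨h, ⟨ha, hb⟩, a, rfl⟩⟩
    · obtain ⟨s⟩ := ‹Nonempty L.Sorts›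
      obtain ⟨a⟩ := M.nonempty s
      obtain ⟨b⟩ := N.nonempty s
      exact ⟨⟨s, a, b⟩, fun h => absurd h hn, fun _ h => absurd h hq⟩
  choose g hg₁ hg₂ using hstep
  have hp₁ : ∀ i : Fin k, seqOf g i = p₀ i := fun i => by
    rw [seqOf_eq]; exact hg₁ i _ i.2
  have hlt : ∀ n, k ≤ n → backForthInfty Δ Ω (fun i : Fin n => seqOf g i) < t := by
    intro n hn
    induction n, hn using Nat.le_induction with
    | base => rwa [funext hp₁]
    | succ n hn ih =>
      rw [prefix_succ, seqOf_eq g n]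
      exact (hg₂ n _ hn ih).1
  have h2 : ∀ n, k ≤ n → Good (seqOf g n) ∧ Match (e n) (seqOf g n) := fun n hn => by
    rw [seqOf_eq g n]
    exact (hg₂ n _ hn (hlt n hn)).2
  refine ⟨seqOf g, hp₁, hlt, fun i => ?_, fun s a ha n => ?_, fun s b hb n => ?_⟩
  · rcases lt_or_ge i k with hi | hi
    · have := hp₀ ⟨i, hi⟩
      rwa [← hp₁ ⟨i, hi⟩] at this
    · exact (h2 i hi).1
  · obtain ⟨i, hi, hei⟩ := he (.inl ⟨s, a, ha⟩) (max n k)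
    have h := (h2 i (le_of_max_le_right hi)).2
    rw [hei] at h
    exact ⟨i, le_of_max_le_left hi, h⟩
  · obtain ⟨i, hi, hei⟩ := he (.inr ⟨s, b, hb⟩) (max n k)
    have h := (h2 i (le_of_max_le_right hi)).2
    rw [hei] at h
    exact ⟨i, le_of_max_le_left hi, h⟩

/-! ### Formulas controlled by a play -/

/-- It is enough for a formula to respect `Ω` in the models of `T` to be controlled by `r_∞`. -/
theorem IsDistortionSystem.gap_le {T : Theory L} {Δ : FormulaSet L}
    (hΔ : IsDistortionSystem.{u, v} T Δ) (Ω : WeakModulus) {M N : Str.{u, v} L}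
    (hM : M.Models T) (hN : N.Models T) {k : ℕ} (p : Fin k → SProd M N)
    (χ : Formula L fun i => (p i).1) (hχ : χ ∈ Δ fun i => (p i).1)
    (hΩ : ∀ K : Str.{u, v} L, K.Models T → χ.RespectsAt Ω 0 K) :
    gap p χ ≤ backForthInfty Δ Ω p := by
  obtain ⟨χ', hχ', hr, he⟩ := hΔ.exists_respects Ω χ hχ hΩ
  have : gap p χ = gap p χ' := by
    unfold gap
    rw [he M hM, he N hN]
  rw [this]
  exact gap_le_backForthInfty Δ Ω p χ' hχ' hr

theorem gap_rename {M N : Str.{u, v} L} {k n : ℕ} (p : Fin n → SProd M N) (W : Fin k → Fin n)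
    (ψ : Formula L fun i => (p (W i)).1) :
    gap p (ψ.rename (Γ' := fun i => (p i).1) W fun _ => rfl) = gap (fun i => p (W i)) ψ := by
  unfold gap
  rw [ψ.eval_rename M W _ _ (fun i => (p (W i)).2.1) fun i => HEq.rfl,
    ψ.eval_rename N W _ _ (fun i => (p (W i)).2.2) fun i => HEq.rfl]

theorem dis_range_le {T : Theory L} {Δ : FormulaSet L}
    (hΔ : IsDistortionSystem.{u, v} T Δ) {Ω : WeakModulus}
    (hΩ : ∀ (k : ℕ) (Γ : Fin k → L.Sorts), ∀ φ ∈ Δ Γ,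
        ∀ K : Str.{u, v} L, K.Models T → φ.RespectsAt Ω 0 K) {M N : Str.{u, v} L}
    (hM : M.Models T) (hN : N.Models T) {p : ℕ → SProd M N} {k : ℕ} {t : ℝ≥0∞}
    (hp : ∀ n, k ≤ n → backForthInfty Δ Ω (fun i : Fin n => p i) < t) :
    dis Δ (Set.range p) ≤ t := by
  refine dis_le Δ fun l q hq φ hφ => ?_
  choose W hW using hq
  obtain rfl : (fun i => p (W i)) = q := funext hW
  let n := max k (Finset.univ.sup W + 1)
  have hn : ∀ i, W i < n := fun i =>
    lt_max_of_lt_right (Nat.lt_succ_of_le (Finset.le_sup (Finset.mem_univ i)))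
  let W' : Fin l → Fin n := fun i => ⟨W i, hn i⟩
  have h := gap_rename (fun i : Fin n => p i) W' φ
  change _ = gap (fun i => p (W i)) φ at h
  rw [← h]
  have hmem := hΔ.rename_mem (Γ' := fun i : Fin n => (p i).1) W' (fun _ => rfl) φ hφ
  exact (hΔ.gap_le Ω hM hN _ _ hmem (hΩ _ _ _ hmem)).trans (hp n (le_max_left _ _)).le

theorem IsAlmostCorrelation.thicken_isCorrelation {M N : Str.{u, v} L} {R : Set (SProd M N)}
    (hR : IsAlmostCorrelation R) {δ : ℝ} (hδ : 0 < δ) : IsCorrelation (thicken R δ) := by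
  obtain ⟨A, B, hA, hB, hAB⟩ := hR
  refine ⟨fun _ _ => ⟨trivial, trivial⟩, fun s a _ => ?_, fun s b _ => ?_⟩
  · obtain ⟨c, hc, hd⟩ := (hA.1 s).exists_dist_lt a hδ
    obtain ⟨b, hb⟩ := hAB.2.1 s c hc
    exact ⟨b, c, b, hb, hd, by simpa using hδ⟩
  · obtain ⟨c, hc, hd⟩ := (hB.1 s).exists_dist_lt b hδ
    obtain ⟨a, ha⟩ := hAB.2.2 s c hc
    exact ⟨a, a, c, ha, by simpa using hδ, hd⟩

theorem subset_thicken {M N : Str.{u, v} L} (R : Set (SProd M N)) {δ : ℝ} (hδ : 0 < δ) :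
    R ⊆ thicken R δ := fun q hq => ⟨q.2.1, q.2.2, hq, by simpa using hδ, by simpa using hδ⟩

theorem IsUUC.rho_le_dis {T : Theory L} {Δ : FormulaSet L} (h : IsUUC.{u, v} T Δ)
    {M N : Str.{u, v} L} (hM : M.Models T) (hN : N.Models T) {R : Set (SProd M N)}
    (hR : IsAlmostCorrelation R) {k : ℕ} (p : Fin k → SProd M N) (hp : ∀ i, p i ∈ R) :
    rho Δ p ≤ dis Δ R := by
  refine ENNReal.le_of_forall_pos_le_add fun ε hε _ => ?_
  obtain ⟨δ, hδ, h⟩ := h ε hε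
  have h := h M N hM hN R hR
  rw [ENNReal.ofReal_coe_nnreal] at h
  refine le_trans ?_ h
  exact iInf₂_le_of_le _ (hR.thicken_isCorrelation hδ)
    (iInf_le_of_le (fun i => subset_thicken R hδ (hp i)) le_rfl)

/-- Without sorts there are only sentences, all of which respect every modulus. -/
theorem rho_le_of_isEmpty [IsEmpty L.Sorts] (Δ : FormulaSet L) (Ω : WeakModulus)
    {M N : Str.{u, v} L} {k : ℕ} (p : Fin k → SProd M N) : rho Δ p ≤ backForthInfty Δ Ω p := by
  have : IsEmpty (SProd M N) := ⟨fun x => isEmptyElim x.1⟩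
  have hk : ∀ {n : ℕ}, (Fin n → SProd M N) → n = 0 := fun {n} q => by
    by_contra h
    exact isEmptyElim (q ⟨0, Nat.pos_of_ne_zero h⟩)
  refine iInf₂_le_of_le Set.univ ⟨fun _ _ => ⟨trivial, trivial⟩, fun s => isEmptyElim s,
    fun s => isEmptyElim s⟩ (iInf_le_of_le (fun _ => trivial) ?_)
  refine dis_le Δ fun n q _ φ hφ => ?_
  obtain rfl := hk p
  obtain rfl := hk q
  obtain rfl : q = p := Subsingleton.elim _ _
  refine gap_le_backForthInfty Δ Ω q φ hφ fun K a b => ?_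
  rw [show a = b from funext fun i => i.elim0]
  simp

/-- In the uniformly uniformly continuous case, the pairs met in an infinite play form an almost
correlation of distortion at most any bound `t > r_∞`. -/
theorem IsUUC.rho_le_backForthInfty (hL : L.IsCountable) {T : Theory L} {Δ : FormulaSet L}
    (hΔ : IsDistortionSystem.{u, v} T Δ) (hU : IsUUC.{u, v} T Δ) {Ω : WeakModulus}
    (hΩ : ∀ (k : ℕ) (Γ : Fin k → L.Sorts), ∀ φ ∈ Δ Γ,
        ∀ K : Str.{u, v} L, K.Models T → φ.RespectsAt Ω 0 K) {M N : Str.{u, v} L}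
    (hM : M.Models T) (hN : N.Models T) (hMs : M.IsSeparable) (hNs : N.IsSeparable) {k : ℕ}
    {Γ : Fin k → L.Sorts} (m : ∀ i, M.carrier (Γ i)) (n : ∀ i, N.carrier (Γ i)) :
    rho Δ (pairs m n) ≤ backForthInfty Δ Ω (pairs m n) := by
  rcases isEmpty_or_nonempty L.Sorts with hS | hS
  · exact rho_le_of_isEmpty Δ Ω _
  obtain ⟨A, hA, hAc, hmA⟩ := exists_countable_isDenseSub hL hMs m
  obtain ⟨B, hB, hBc, hnB⟩ := exists_countable_isDenseSub hL hNs n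
  refine le_of_forall_gt_imp_ge_of_dense fun t ht => ?_
  obtain ⟨p, hp₀, hp, hAB, hA', hB'⟩ := hΔ.exists_play Ω hA.1 hB.1 hAc hBc (pairs m n)
    (fun i => ⟨hmA i, hnB i⟩) ht
  have hR : IsAlmostCorrelation (Set.range p) := by
    refine ⟨A, B, hA, hB, ?_, fun s a ha => ?_, fun s b hb => ?_⟩
    · rintro _ ⟨i, rfl⟩
      exact hAB i
    · obtain ⟨i, -, b, h⟩ := hA' s a ha 0
      exact ⟨b, i, h⟩
    · obtain ⟨i, -, a, h⟩ := hB' s b hb 0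
      exact ⟨a, i, h⟩
  exact (hU.rho_le_dis hM hN hR _ fun i => ⟨i, hp₀ i⟩).trans (dis_range_le hΔ hΩ hM hN hp)

/-! ### Metric ultraproducts -/

/-- The limit of a bounded family of reals along an ultrafilter. -/
def ulim (U : Ultrafilter ℕ) (f : ℕ → ℝ) : ℝ := limUnder (U : Filter ℕ) f

theorem tendsto_ulim (U : Ultrafilter ℕ) {f : ℕ → ℝ} {a b : ℝ} (h : ∀ n, f n ∈ Set.Icc a b) :
    Tendsto f U (𝓝 (ulim U f)) := by
  obtain ⟨x, -, hx⟩ := (isCompact_Icc (a := a) (b := b)).ultrafilter_le_nhds (U.map f)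
    (le_principal_iff.2 (Ultrafilter.mem_map.2 (Filter.Eventually.of_forall h)))
  exact tendsto_nhds_limUnder ⟨x, hx⟩

section Ultraproduct

variable (K : ℕ → Str.{u, v} L) (U : Ultrafilter ℕ)

/-- Sequences of elements of a sort, with the limit along `U` of their distances as
pseudo-metric. -/
structure PreUltra (_U : Ultrafilter ℕ) (s : L.Sorts) : Type v where
  seq : ∀ n, (K n).carrier s

variable {K U} in
theorem tendsto_dist_ulim {s : L.Sorts} (x y : PreUltra K U s) :
    Tendsto (fun n => dist (x.seq n) (y.seq n)) U (𝓝 (ulim U fun n => dist (x.seq n) (y.seq n))) :=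
  tendsto_ulim U fun n => ⟨dist_nonneg, (K n).dist_le s (x.seq n) (y.seq n)⟩

instance (s : L.Sorts) : PseudoMetricSpace (PreUltra K U s) where
  dist x y := ulim U fun n => dist (x.seq n) (y.seq n)
  dist_self x := by
    refine tendsto_nhds_unique (tendsto_dist_ulim x x) ?_
    simp only [dist_self]
    exact tendsto_const_nhds
  dist_comm x y := by simp only [dist_comm]
  dist_triangle x y z :=
    le_of_tendsto_of_tendsto' (tendsto_dist_ulim x z)
      ((tendsto_dist_ulim x y).add (tendsto_dist_ulim y z)) fun n => dist_triangle _ _ _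

variable {K U}

theorem PreUltra.tendsto_dist {s : L.Sorts} (x y : PreUltra K U s) :
    Tendsto (fun n => Dist.dist (x.seq n) (y.seq n)) U (𝓝 (Dist.dist x y)) := tendsto_dist_ulim x y

/-- A sequence `x` with summable distances has a limit: changing each `x (k + 1)` on a `U`-small
set, one may assume the distances to be small in every coordinate, and take coordinatewise
limits. -/
instance (s : L.Sorts) : CompleteSpace (PreUltra K U s) := by
  refine Metric.complete_of_convergent_controlled_sequences (fun k => (1 / 2 : ℝ) ^ k)
    (fun k => by positivity) fun x hx => ?_
  let step : ∀ (n : ℕ), ℕ → (K n).carrier s := fun n k => Nat.rec ((x 0).seq n)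
    (fun k y => if Dist.dist y ((x (k + 1)).seq n) < (1 / 2 : ℝ) ^ k then (x (k + 1)).seq n
      else y) k
  have hstep : ∀ n k, step n (k + 1) = if Dist.dist (step n k) ((x (k + 1)).seq n) < (1 / 2 : ℝ) ^ k
      then (x (k + 1)).seq n else step n k := fun n k => rfl
  have hd : ∀ n k, Dist.dist (step n k) (step n (k + 1)) ≤ (1 : ℝ) * (1 / 2 : ℝ) ^ k := by
    intro n k
    rw [hstep, one_mul]
    split_ifs with h
    · exact h.le
    · simp
  have hev : ∀ k, ∀ᶠ n in (U : Filter ℕ), step n k = (x k).seq n := by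
    intro k
    induction k with
    | zero => exact Eventually.of_forall fun n => rfl
    | succ k ih =>
      have h1 : ∀ᶠ n in (U : Filter ℕ),
          Dist.dist ((x k).seq n) ((x (k + 1)).seq n) < (1 / 2 : ℝ) ^ k :=
        (PreUltra.tendsto_dist _ _).eventually_lt_const (hx k k (k + 1) le_rfl (Nat.le_succ k))
      filter_upwards [ih, h1] with n hn1 hn2
      rw [hstep, hn1, if_pos hn2]
  have hc : ∀ n, CauchySeq (step n) := fun n =>
    cauchySeq_of_le_geometric (1 / 2) 1 (by norm_num) (hd n)
  choose y hy using fun n => cauchySeq_tendsto_of_complete (hc n)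
  refine ⟨⟨y⟩, tendsto_iff_dist_tendsto_zero.2 ?_⟩
  have hle : ∀ k, Dist.dist (x k) (⟨y⟩ : PreUltra K U s) ≤ 1 * (1 / 2 : ℝ) ^ k / (1 - 1 / 2) := by
    intro k
    refine le_of_tendsto (PreUltra.tendsto_dist _ _) ?_
    filter_upwards [hev k] with n hn
    rw [← hn]
    exact dist_le_of_le_geometric_of_tendsto (1 / 2) 1 (by norm_num) (hd n) (hy n) k
  refine squeeze_zero (fun _ => dist_nonneg) hle ?_
  have : Tendsto (fun k : ℕ => 1 * (1 / 2 : ℝ) ^ k / (1 - 1 / 2)) atTop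
      (𝓝 (1 * 0 / (1 - 1 / 2))) :=
    ((tendsto_pow_atTop_nhds_zero_of_lt_one (by norm_num) (by norm_num)).const_mul 1).div_const _
  simpa using this

/-- The element of the ultraproduct represented by a sequence. -/
def umk {s : L.Sorts} (x : PreUltra K U s) : SeparationQuotient (PreUltra K U s) :=
  SeparationQuotient.mk x

theorem umk_surjective {s : L.Sorts} (x : SeparationQuotient (PreUltra K U s)) :
    ∃ y : PreUltra K U s, umk y = x := SeparationQuotient.surjective_mk x

theorem dist_umk {s : L.Sorts} (x y : PreUltra K U s) : dist (umk x) (umk y) = dist x y :=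
  SeparationQuotient.dist_mk x y

/-- A sequence representing an element of the ultraproduct. -/
def rep {s : L.Sorts} (x : SeparationQuotient (PreUltra K U s)) : PreUltra K U s :=
  (umk_surjective x).choose

theorem umk_rep {s : L.Sorts} (x : SeparationQuotient (PreUltra K U s)) : umk (rep x) = x :=
  (umk_surjective x).choose_spec

theorem eventually_dist_lt {s : L.Sorts} {x y : PreUltra K U s} {c : ℝ} (h : dist x y < c) :
    ∀ᶠ n in (U : Filter ℕ), dist (x.seq n) (y.seq n) < c :=
  (PreUltra.tendsto_dist x y).eventually_lt_const h

variable (K U) in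
/-- The metric ultraproduct of a sequence of structures. -/
def ultraproduct : Str.{u, v} L where
  carrier s := SeparationQuotient (PreUltra K U s)
  metric _ := inferInstance
  complete _ := inferInstance
  nonempty s := ⟨umk ⟨fun n => ((K n).nonempty s).some⟩⟩
  dist_le s a b := by
    rw [← umk_rep a, ← umk_rep b, dist_umk]
    exact le_of_tendsto' (PreUltra.tendsto_dist _ _) fun n => (K n).dist_le s _ _
  fn f a := umk ⟨fun n => (K n).fn f fun i => (rep (a i)).seq n⟩
  fn_unif f ε hε a b hab := by
    rw [dist_umk]
    refine le_of_tendsto (PreUltra.tendsto_dist _ _) ?_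
    have h : ∀ i, ∀ᶠ n in (U : Filter ℕ),
        dist ((rep (a i)).seq n) ((rep (b i)).seq n) < L.fnMod f ε :=
      fun i => eventually_dist_lt (by rw [← dist_umk, umk_rep, umk_rep]; exact hab i)
    filter_upwards [eventually_all.2 h] with n hn
    exact (K n).fn_unif f ε hε _ _ hn
  pred P a := ulim U fun n => (K n).pred P fun i => (rep (a i)).seq n
  pred_mem P a :=
    isClosed_Icc.mem_of_tendsto (tendsto_ulim U fun n => (K n).pred_mem P _)
      (Eventually.of_forall fun n => (K n).pred_mem P _)
  pred_unif P ε hε a b hab := by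
    refine le_of_tendsto ((tendsto_ulim U fun n => (K n).pred_mem P _).sub
      (tendsto_ulim U fun n => (K n).pred_mem P _)).abs ?_
    have h : ∀ i, ∀ᶠ n in (U : Filter ℕ),
        dist ((rep (a i)).seq n) ((rep (b i)).seq n) < L.predMod P ε :=
      fun i => eventually_dist_lt (by rw [← dist_umk, umk_rep, umk_rep]; exact hab i)
    filter_upwards [eventually_all.2 h] with n hn
    exact (K n).pred_unif P ε hε _ _ hn

theorem eventually_rep_umk {s : L.Sorts} (x : PreUltra K U s) {c : ℝ} (hc : 0 < c) :
    ∀ᶠ n in (U : Filter ℕ), dist ((rep (umk x)).seq n) (x.seq n) < c :=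
  eventually_dist_lt (by rw [← dist_umk, umk_rep, dist_self]; exact hc)

theorem Term.eval_ultraproduct {n : ℕ} {Γ : Fin n → L.Sorts} {s : L.Sorts} (t : Term L Γ s)
    (x : ∀ i, PreUltra K U (Γ i)) :
    t.eval (ultraproduct K U) (fun i => umk (x i)) =
      umk (U := U) ⟨fun j => t.eval (K j) fun i => (x i).seq j⟩ := by
  induction t with
  | var i => rfl
  | app f t ih =>
    simp only [Term.eval, ih]
    change umk ⟨fun _ => _⟩ = _
    refine dist_le_zero.1 ?_
    rw [dist_umk]
    refine le_of_forall_pos_le_add fun ε hε => ?_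
    rw [zero_add]
    refine le_of_tendsto (PreUltra.tendsto_dist _ _) ?_
    filter_upwards [eventually_all.2 fun i => eventually_rep_umk (U := U)
      ⟨fun j => (t i).eval (K j) fun i => (x i).seq j⟩ (L.fnMod_pos f ε hε)] with j hj
    exact (K j).fn_unif f ε hε _ _ hj

/-- The fundamental theorem of ultraproducts: the value of a formula in the ultraproduct is the
limit of its values in the factors. -/
theorem Formula.tendsto_eval_ultraproduct {n : ℕ} {Γ : Fin n → L.Sorts} (φ : Formula L Γ)
    (x : ∀ i, PreUltra K U (Γ i)) :
    Tendsto (fun j => φ.eval (K j) fun i => (x i).seq j) U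
      (𝓝 (φ.eval (ultraproduct K U) fun i => umk (x i))) := by
  have hcons : ∀ {n : ℕ} {Γ : Fin n → L.Sorts} {s : L.Sorts} (x : ∀ i, PreUltra K U (Γ i))
      (y : PreUltra K U s), (fun i => umk (Fin.cons (α := fun i => PreUltra K U (consCtx s Γ i))
        y x i)) = consVal (ultraproduct K U) (Γ := Γ) (umk y) fun i => umk (x i) :=
    fun x y => funext (Fin.cases rfl fun i => rfl)
  have hcons' : ∀ {n : ℕ} {Γ : Fin n → L.Sorts} {s : L.Sorts} (x : ∀ i, PreUltra K U (Γ i))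
      (y : PreUltra K U s) (j : ℕ), (fun i => ((Fin.cons
        (α := fun i => PreUltra K U (consCtx s Γ i)) y x : ∀ i, _) i).seq j) =
        consVal (K j) (Γ := Γ) (y.seq j) fun i => (x i).seq j :=
    fun x y j => funext (Fin.cases rfl fun i => rfl)
  induction φ with
  | const r => exact tendsto_const_nhds
  | dist t₁ t₂ =>
    simp only [Formula.eval, Term.eval_ultraproduct]
    have h := PreUltra.tendsto_dist (U := U) ⟨fun j => t₁.eval (K j) fun i => (x i).seq j⟩
      ⟨fun j => t₂.eval (K j) fun i => (x i).seq j⟩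
    rwa [← dist_umk] at h
  | pred P t =>
    simp only [Formula.eval, Term.eval_ultraproduct]
    have h1 : Tendsto _ _ (𝓝 ((ultraproduct K U).pred P
      fun i => umk ⟨fun j => (t i).eval (K j) fun i => (x i).seq j⟩)) :=
      tendsto_ulim U fun n => (K n).pred_mem P _
    refine (tendsto_iff_of_dist (Metric.tendsto_nhds.2 fun ε hε => ?_)).1 h1
    filter_upwards [eventually_all.2 fun i => eventually_rep_umk (U := U)
      ⟨fun j => (t i).eval (K j) fun i => (x i).seq j⟩
      (L.predMod_pos P (ε / 2) (half_pos hε))] with j hj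
    rw [Real.dist_0_eq_abs, abs_of_nonneg dist_nonneg]
    exact ((K j).pred_unif P _ (half_pos hε) _ _ hj).trans_lt (half_lt_self hε)
  | conn F hF φ ih =>
    simp only [Formula.eval]
    exact (hF.tendsto _).comp (tendsto_pi_nhds.2 fun j => ih j x)
  | @sup n Γ s φ ih =>
    have ih' : ∀ y : PreUltra K U s, Tendsto
        (fun j => φ.eval (K j) (consVal (K j) (Γ := Γ) (y.seq j) fun i => (x i).seq j)) U
        (𝓝 (φ.eval (ultraproduct K U) (consVal (ultraproduct K U) (Γ := Γ) (umk y)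
          fun i => umk (x i)))) := by
      intro y
      have h := ih (Fin.cons (α := fun i => PreUltra K U (consCtx s Γ i)) y x)
      simpa only [hcons, hcons'] using h
    obtain ⟨C, hC⟩ := φ.sup.exists_bound
    have hl := tendsto_ulim U fun j => abs_le.1 (hC (K j) fun i => (x i).seq j)
    have hU := φ.isLUB_eval_sup (ultraproduct K U) fun i => umk (x i)
    suffices he : ulim U (fun j => φ.sup.eval (K j) fun i => (x i).seq j) =
        φ.sup.eval (ultraproduct K U) fun i => umk (x i) from he ▸ hl
    refine le_antisymm ?_ (hU.2 ?_)
    · -- Near-optimal elements of the factors represent a near-optimal element.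
      refine le_of_forall_pos_sub_le fun ε hε => ?_
      choose y hy using fun j => (lt_isLUB_iff (φ.isLUB_eval_sup (K j) fun i => (x i).seq j)).1
        (sub_lt_self _ hε)
      choose z hz using fun j => (hy j).1
      refine (le_of_tendsto_of_tendsto' (hl.sub_const ε) (ih' ⟨z⟩) fun j => ?_).trans
        (hU.1 ⟨_, rfl⟩)
      exact (hy j).2.le.trans_eq (hz j).symm
    · rintro _ ⟨X, rfl⟩
      obtain ⟨y, rfl⟩ := umk_surjective X
      exact le_of_tendsto_of_tendsto' (ih' y) hl fun j =>
        (φ.isLUB_eval_sup (K j) fun i => (x i).seq j).1 ⟨_, rfl⟩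
  | @inf n Γ s φ ih =>
    have ih' : ∀ y : PreUltra K U s, Tendsto
        (fun j => φ.eval (K j) (consVal (K j) (Γ := Γ) (y.seq j) fun i => (x i).seq j)) U
        (𝓝 (φ.eval (ultraproduct K U) (consVal (ultraproduct K U) (Γ := Γ) (umk y)
          fun i => umk (x i)))) := by
      intro y
      have h := ih (Fin.cons (α := fun i => PreUltra K U (consCtx s Γ i)) y x)
      simpa only [hcons, hcons'] using h
    obtain ⟨C, hC⟩ := φ.inf.exists_bound
    have hl := tendsto_ulim U fun j => abs_le.1 (hC (K j) fun i => (x i).seq j)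
    have hU := φ.isGLB_eval_inf (ultraproduct K U) fun i => umk (x i)
    suffices he : ulim U (fun j => φ.inf.eval (K j) fun i => (x i).seq j) =
        φ.inf.eval (ultraproduct K U) fun i => umk (x i) from he ▸ hl
    refine le_antisymm (hU.2 ?_) ?_
    · rintro _ ⟨X, rfl⟩
      obtain ⟨y, rfl⟩ := umk_surjective X
      exact le_of_tendsto_of_tendsto' hl (ih' y) fun j =>
        (φ.isGLB_eval_inf (K j) fun i => (x i).seq j).1 ⟨_, rfl⟩
    · refine le_of_forall_pos_le_add fun ε hε => ?_
      choose y hy using fun j => (isGLB_lt_iff (φ.isGLB_eval_inf (K j) fun i => (x i).seq j)).1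
        (lt_add_of_pos_right _ hε)
      choose z hz using fun j => (hy j).1
      refine (hU.1 ⟨_, rfl⟩).trans
        (le_of_tendsto_of_tendsto' (ih' ⟨z⟩) (hl.add_const ε) fun j => ?_)
      exact (hz j).trans_le (hy j).2.le

theorem models_ultraproduct {T : Theory L} (h : ∀ n, (K n).Models T) :
    (ultraproduct K U).Models T := by
  intro φ hφ
  have ht := φ.tendsto_eval_ultraproduct (K := K) (U := U) fun i => i.elim0
  have he : (fun i : Fin 0 => umk (U := U) (K := K) (s := emptyCtx L i) (i.elim0)) =
      fun i => i.elim0 := funext fun i => i.elim0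
  rw [he] at ht
  refine le_of_tendsto' ht fun j => ?_
  rw [show (fun i : Fin 0 => PreUltra.seq (s := emptyCtx L i) (K := K) (_U := U) (i.elim0) j) =
    fun i => i.elim0 from funext fun i => i.elim0]
  exact h j φ hφ

end Ultraproduct

/-! ### Formulas separating points in the functional case -/

/-- A formula of `Δ` in two variables of sort `s` bounding the variation of `θ` in its variable
`w`. -/
theorem IsDistortionSystem.exists_variation_of_sort {T : Theory L} {Δ : FormulaSet L}
    (hΔ : IsDistortionSystem.{u, v} T Δ) {n : ℕ} {Γ : Fin n → L.Sorts} (θ : Formula L Γ)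
    (hθ : θ ∈ Δ Γ) (w : Fin n) {s : L.Sorts} (hs : Γ w = s) :
    ∃ E ∈ Δ (fun _ : Fin 2 => s),
      (∀ (K : Str.{u, v} L) (x : Fin 2 → K.carrier s), x 0 = x 1 → E.eval K x = 0) ∧
      ∀ (K : Str.{u, v} L) (x : Fin 2 → K.carrier s) (y : ∀ i, K.carrier (Γ i))
        (z₀ z₁ : K.carrier (Γ w)), z₀ ≍ x 0 → z₁ ≍ x 1 →
        |θ.eval K (Function.update y w z₀) - θ.eval K (Function.update y w z₁)| ≤
          2 * E.eval K x := by
  subst hs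
  obtain ⟨E, hE, h⟩ := hΔ.exists_variation θ hθ w
  refine ⟨E, hE, fun K x hx => ?_, fun K x y z₀ z₁ h₀ h₁ => ?_⟩
  · have h' := h K x
    rw [hx] at h'
    simp only [sub_self, abs_zero, zero_div] at h'
    have : Nonempty (∀ i, K.carrier (Γ i)) := ⟨fun i => (K.nonempty _).some⟩
    rw [Set.range_const] at h'
    exact h'.unique isLUB_singleton
  · obtain rfl := eq_of_heq h₀
    obtain rfl := eq_of_heq h₁
    have := (h K x).1 ⟨y, rfl⟩
    dsimp only at this
    linarith

theorem exists_assignment (K : Str.{u, v} L) {n m : ℕ} {Γ : Fin n → L.Sorts}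
    {Θ : Fin m → L.Sorts} {g : Fin n → Fin m} (hg : g.Injective) (h : ∀ i, Θ (g i) = Γ i)
    (y : ∀ i, K.carrier (Γ i)) : ∃ a : ∀ l, K.carrier (Θ l), ∀ i, a (g i) ≍ y i := by
  have key : ∀ l, ∃ z : K.carrier (Θ l), ∀ i, g i = l → z ≍ y i := by
    intro l
    by_cases hl : ∃ i, g i = l
    · obtain ⟨i, rfl⟩ := hl
      refine ⟨cast (congrArg K.carrier (h i).symm) (y i), fun j hj => ?_⟩
      obtain rfl := hg hj
      exact cast_heq _ _
    · exact ⟨(K.nonempty _).some, fun i hi => absurd ⟨i, hi⟩ hl⟩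
  choose a ha using key
  exact ⟨a, fun i => ha _ i rfl⟩

/-- If the variations of all members of a dense sequence are small at two elements `b`, `b'`, then
no formula of `Δ` tells `b` and `b'` apart by much. -/
theorem abs_sub_le_of_dense {T : Theory L} {Δ : FormulaSet L}
    {φ : ℕ → Σ (n : ℕ) (Γ : Fin n → L.Sorts), Formula L Γ} (hφ : IsDenseSeq.{u, v} T Δ φ)
    {K : Str.{u, v} L} (hK : K.Models T) {s : L.Sorts} {b b' : K.carrier s} {c : ℝ} (hc : 0 ≤ c)
    (h : ∀ i (w : Fin (φ i).1) (y : ∀ i', K.carrier ((φ i).2.1 i'))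
      (z₀ z₁ : K.carrier ((φ i).2.1 w)), (φ i).2.1 w = s → z₀ ≍ b → z₁ ≍ b' →
      |(φ i).2.2.eval K (Function.update y w z₀) - (φ i).2.2.eval K (Function.update y w z₁)| ≤ c)
    {n : ℕ} {Γ : Fin n → L.Sorts} (θ : Formula L (consCtx s Γ)) (hθ : θ ∈ Δ (consCtx s Γ))
    (y : ∀ i, K.carrier (Γ i)) :
    |θ.eval K (consVal K b y) - θ.eval K (consVal K b' y)| ≤ c := by
  refine le_of_forall_pos_le_add fun η hη => ?_
  obtain ⟨i, l, Θ, f, hf, g, hg, hfi, hgi, hw⟩ := hφ.2 _ _ θ hθ (η / 2) (half_pos hη)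
  obtain ⟨a, ha⟩ := exists_assignment K hgi hg (consVal K b y)
  have hs : s = Θ (g 0) := (hg 0).symm
  let z : K.carrier (Θ (g 0)) := cast (congrArg K.carrier hs) b'
  have hz : z ≍ b' := cast_heq _ _
  let a' : ∀ l, K.carrier (Θ l) := Function.update a (g 0) z
  have ha' : ∀ i, a' (g i) ≍ consVal K b' y i := by
    refine Fin.cases ?_ fun j => ?_
    · simp only [a', Function.update_self]
      exact hz
    · simp only [a']
      rw [Function.update_of_ne fun e => Fin.succ_ne_zero j (hgi e)]
      exact ha j.succ
  have h1 := hw K hK a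
  have h2 := hw K hK a'
  rw [θ.eval_rename K g hg a _ fun i => (ha i).symm] at h1
  rw [θ.eval_rename K g hg a' _ fun i => (ha' i).symm] at h2
  let d : ∀ v, K.carrier ((φ i).2.1 v) := fun v => cast (congrArg K.carrier (hf v)) (a (f v))
  let d' : ∀ v, K.carrier ((φ i).2.1 v) := fun v => cast (congrArg K.carrier (hf v)) (a' (f v))
  have hd : ∀ v, d v ≍ a (f v) := fun v => cast_heq _ _
  have hd' : ∀ v, d' v ≍ a' (f v) := fun v => cast_heq _ _
  rw [(φ i).2.2.eval_rename K f hf a d hd] at h1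
  rw [(φ i).2.2.eval_rename K f hf a' d' hd'] at h2
  have h3 : |(φ i).2.2.eval K d - (φ i).2.2.eval K d'| ≤ c := by
    by_cases hv : ∃ v, f v = g 0
    · obtain ⟨v, hv⟩ := hv
      have e : Function.update d v (d' v) = d' := by
        funext v'
        by_cases hvv : v' = v
        · subst hvv
          rw [Function.update_self]
        · rw [Function.update_of_ne hvv]
          refine eq_of_heq ((hd v').trans (HEq.trans ?_ (hd' v').symm))
          simp only [a']
          rw [Function.update_of_ne fun e => hvv (hfi (e.trans hv.symm))]
      have hget : ∀ (a : ∀ l, K.carrier (Θ l)), a (f v) ≍ a (g 0) := fun a => by rw [hv]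
      have := h i v d (d v) (d' v) ((hf v).symm.trans ((congrArg Θ hv).trans hs.symm))
        ((hd v).trans ((hget a).trans (ha 0))) ((hd' v).trans ((hget a').trans (ha' 0)))
      rwa [Function.update_eq_self, e] at this
    · have : d = d' := by
        funext v
        refine eq_of_heq ((hd v).trans (HEq.trans ?_ (hd' v).symm))
        simp only [a']
        rw [Function.update_of_ne fun e => hv ⟨v, e⟩]
      rw [this, sub_self, abs_zero]
      exact hc
  have e1 := abs_le.1 h1
  have e2 := abs_le.1 h2
  have e3 := abs_le.1 h3
  exact abs_le.2 ⟨by linarith [e1.1, e1.2, e2.1, e2.2, e3.1], by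
    linarith [e1.1, e1.2, e2.1, e2.2, e3.2]⟩

/-- The diagonal of a structure with one further pair of elements. -/
def diagInsert {K : Str.{u, v} L} {s : L.Sorts} (b b' : K.carrier s) : Set (SProd K K) :=
  {q | q.2.1 = q.2.2 ∨ q = ⟨s, b, b'⟩}

theorem dis_diagInsert_le {T : Theory L} {Δ : FormulaSet L}
    (hΔ : IsDistortionSystem.{u, v} T Δ) {K : Str.{u, v} L} {s : L.Sorts} {b b' : K.carrier s}
    {c : ℝ} (h : ∀ {n : ℕ} {Γ : Fin n → L.Sorts} (θ : Formula L (consCtx s Γ)),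
      θ ∈ Δ (consCtx s Γ) → ∀ y : ∀ i, K.carrier (Γ i),
        |θ.eval K (consVal K b y) - θ.eval K (consVal K b' y)| ≤ c) :
    dis Δ (diagInsert b b') ≤ ENNReal.ofReal c := by
  classical
  refine dis_le Δ fun n p hp φ hφ => ENNReal.ofReal_le_ofReal ?_
  let r : Fin n → Fin (n + 1) := fun i => if p i = ⟨s, b, b'⟩ then 0 else i.succ
  have hr : ∀ i, consCtx s (fun i => (p i).1) (r i) = (p i).1 := by
    intro i
    by_cases hi : p i = ⟨s, b, b'⟩
    · simp only [r]
      rw [if_pos hi, hi]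
      rfl
    · simp only [r]
      rw [if_neg hi]
      rfl
  have := h _ (hΔ.rename_mem r hr φ hφ) fun i => (p i).2.1
  rwa [φ.eval_rename K r hr _ (fun i => (p i).2.1), φ.eval_rename K r hr _ (fun i => (p i).2.2)]
    at this
  · intro i
    by_cases hi : p i = ⟨s, b, b'⟩
    · simp only [r]
      rw [if_pos hi, hi]
      exact HEq.rfl
    · simp only [r]
      rw [if_neg hi, ← (hp i).resolve_right hi]
      exact HEq.rfl
  · intro i
    by_cases hi : p i = ⟨s, b, b'⟩
    · simp only [r]
      rw [if_pos hi, hi]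
      exact HEq.rfl
    · simp only [r]
      rw [if_neg hi]
      exact HEq.rfl

theorem isCorrelation_diagInsert {K : Str.{u, v} L} {s : L.Sorts} (b b' : K.carrier s) :
    IsCorrelation (diagInsert b b') :=
  ⟨fun _ _ => ⟨trivial, trivial⟩, fun _ a _ => ⟨a, .inl rfl⟩, fun _ a _ => ⟨a, .inl rfl⟩⟩

theorem isClosed_diagInsert {K : Str.{u, v} L} {s : L.Sorts} (b b' : K.carrier s)
    (s' : L.Sorts) :
    IsClosed {q : K.carrier s' × K.carrier s' | (⟨s', q⟩ : SProd K K) ∈ diagInsert b b'} := by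
  have h1 : IsClosed {q : K.carrier s' × K.carrier s' | q.1 = q.2} :=
    isClosed_eq continuous_fst continuous_snd
  have h2 : IsClosed {q : K.carrier s' × K.carrier s' | (⟨s', q⟩ : SProd K K) = ⟨s, b, b'⟩} := by
    by_cases h : s' = s
    · subst h
      simp only [Sigma.mk.injEq, heq_eq_eq, true_and, Set.ofPred_eq_eq_singleton]
      exact isClosed_singleton
    · simp [h]
  exact h1.union h2

/-- The conclusion of functionality, for one value `ε` of the distortion. -/
def FunctionalBelow (T : Theory L) (Δ : FormulaSet L) (ε : ℝ) : Prop :=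
  ∀ (M N : Str.{u, v} L), M.Models T → N.Models T →
    ∀ R : Set (SProd M N), IsAlmostCorrelation R →
      (∀ s, IsClosed {q : M.carrier s × N.carrier s | (⟨s, q⟩ : SProd M N) ∈ R}) →
      dis Δ R < ENNReal.ofReal ε →
      ∃ e : ∀ s, M.carrier s ≃ᵤ N.carrier s, R = {q | e q.1 q.2.1 = q.2.2}

/-- In the functional case, distinct elements are told apart by some formula: otherwise adding a
pair of them to the diagonal yields a relation of small distortion which is not a graph. -/
theorem FunctionalBelow.eq_of_forall {T : Theory L} {Δ : FormulaSet L} {ε c : ℝ}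
    (hF : FunctionalBelow.{u, v} T Δ ε) (hε : 0 < ε) (hc : c < ε)
    (hΔ : IsDistortionSystem.{u, v} T Δ) {K : Str.{u, v} L} (hK : K.Models T) {s : L.Sorts}
    {b b' : K.carrier s} (h : ∀ {n : ℕ} {Γ : Fin n → L.Sorts} (θ : Formula L (consCtx s Γ)),
      θ ∈ Δ (consCtx s Γ) → ∀ y : ∀ i, K.carrier (Γ i),
        |θ.eval K (consVal K b y) - θ.eval K (consVal K b' y)| ≤ c) : b = b' := by
  obtain ⟨e, he⟩ := hF K K hK hK _ (isCorrelation_diagInsert b b').isAlmostCorrelation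
    (isClosed_diagInsert b b')
    ((dis_diagInsert_le hΔ h).trans_lt ((ENNReal.ofReal_lt_ofReal_iff hε).2 hc))
  have h1 : (⟨s, b, b⟩ : SProd K K) ∈ diagInsert b b' := .inl rfl
  have h2 : (⟨s, b, b'⟩ : SProd K K) ∈ diagInsert b b' := .inr rfl
  rw [he] at h1 h2
  exact h1.symm.trans h2

/-- The variations of the members of a dense sequence in their variables of sort `s`, as one
sequence of formulas in two variables. -/
theorem IsDistortionSystem.exists_variation_seq {T : Theory L} {Δ : FormulaSet L}
    (hΔ : IsDistortionSystem.{u, v} T Δ)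
    {φ : ℕ → Σ (n : ℕ) (Γ : Fin n → L.Sorts), Formula L Γ}
    (hφ : ∀ i, (φ i).2.2 ∈ Δ (φ i).2.1) (s : L.Sorts) :
    ∃ E : ℕ → Formula L (fun _ : Fin 2 => s), (∀ j, E j ∈ Δ _) ∧
      (∀ j (K : Str.{u, v} L) (x : Fin 2 → K.carrier s), x 0 = x 1 → (E j).eval K x = 0) ∧
      ∀ i (w : Fin (φ i).1), (φ i).2.1 w = s → ∃ j, ∀ (K : Str.{u, v} L)
        (x : Fin 2 → K.carrier s) (y : ∀ i', K.carrier ((φ i).2.1 i'))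
        (z₀ z₁ : K.carrier ((φ i).2.1 w)), z₀ ≍ x 0 → z₁ ≍ x 1 →
        |(φ i).2.2.eval K (Function.update y w z₀) - (φ i).2.2.eval K (Function.update y w z₁)| ≤
          2 * (E j).eval K x := by
  choose V hV₁ hV₂ hV₃ using fun (x : Σ i : ℕ, {w : Fin (φ i).1 // (φ i).2.1 w = s}) =>
    hΔ.exists_variation_of_sort (φ x.1).2.2 (hφ x.1) x.2.1 x.2.2
  obtain ⟨e, he⟩ := exists_surjective_nat
    (Option (Σ i : ℕ, {w : Fin (φ i).1 // (φ i).2.1 w = s}))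
  refine ⟨fun j => (e j).elim (.const 0) V, fun j => ?_, fun j K x hx => ?_, fun i w hw => ?_⟩
  · beta_reduce
    rcases e j with - | y
    · exact hΔ.const_mem 0
    · exact hV₁ y
  · beta_reduce
    rcases e j with - | y
    · rfl
    · exact hV₂ y K x hx
  · obtain ⟨j, hj⟩ := he (some ⟨i, w, hw⟩)
    refine ⟨j, ?_⟩
    simp only [hj, Option.elim]
    exact hV₃ ⟨i, w, hw⟩

/-- The maximum of the first `N + 1` formulas of a sequence. -/
theorem IsDistortionSystem.exists_max {T : Theory L} {Δ : FormulaSet L}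
    (hΔ : IsDistortionSystem.{u, v} T Δ) {n : ℕ} {Γ : Fin n → L.Sorts} (E : ℕ → Formula L Γ)
    (hE : ∀ j, E j ∈ Δ Γ) (N : ℕ) : ∃ D ∈ Δ Γ,
      (∀ (K : Str.{u, v} L) x, (∀ j, (E j).eval K x = 0) → D.eval K x = 0) ∧
      ∀ (K : Str.{u, v} L) x, ∀ j ≤ N, (E j).eval K x ≤ D.eval K x := by
  have hne : (Finset.range (N + 1)).Nonempty := ⟨0, by simp⟩
  let F : (ℕ → ℝ) → ℝ := fun r => (Finset.range (N + 1)).sup' hne r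
  have hF : Continuous F := Continuous.finset_sup'_apply hne fun i _ => continuous_apply i
  have hle : ∀ (x y : ℕ → ℝ) (ε : ℝ), (∀ j, |x j - y j| ≤ ε) → F x ≤ F y + ε := by
    intro x y ε h
    refine Finset.sup'_le hne _ fun j hj => ?_
    have h1 := Finset.le_sup' y hj
    have h2 := (abs_le.1 (h j)).2
    change _ ≤ (Finset.range (N + 1)).sup' hne y + ε
    linarith
  refine ⟨.conn F hF E, hΔ.lipschitz_conn_mem F hF (fun x y ε h => ?_) E hE,
    fun K x h => ?_, fun K x j hj => ?_⟩
  · have h1 := hle x y ε h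
    have h2 := hle y x ε fun j => by rw [abs_sub_comm]; exact h j
    exact abs_le.2 ⟨by linarith, by linarith⟩
  · simp only [Formula.eval, h, F]
    exact Finset.sup'_const hne 0
  · exact Finset.le_sup' (fun j => (E j).eval K x) (Finset.mem_range.2 (Nat.lt_succ_of_le hj))

/-- Functionality is witnessed uniformly by formulas in two variables. By compactness, in the form
of an ultraproduct of counterexamples, finitely many variations suffice for each `δ`. -/
theorem FunctionalBelow.exists_separating {T : Theory L} {Δ : FormulaSet L} {ε : ℝ}
    (hF : FunctionalBelow.{u, v} T Δ ε) (hε : 0 < ε) (hΔ : IsDistortionSystem.{u, v} T Δ)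
    {φ : ℕ → Σ (n : ℕ) (Γ : Fin n → L.Sorts), Formula L Γ} (hφ : IsDenseSeq.{u, v} T Δ φ)
    (s : L.Sorts) {δ : ℝ} (hδ : 0 < δ) : ∃ D ∈ Δ (fun _ : Fin 2 => s),
      (∀ (K : Str.{u, v} L) (x : Fin 2 → K.carrier s), x 0 = x 1 → D.eval K x = 0) ∧
      ∀ (K : Str.{u, v} L), K.Models T → ∀ x : Fin 2 → K.carrier s, δ ≤ dist (x 0) (x 1) →
        ε / 4 ≤ D.eval K x := by
  obtain ⟨E, hE₁, hE₂, hE₃⟩ := hΔ.exists_variation_seq hφ.1 s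
  choose D hD₁ hD₂ hD₃ using hΔ.exists_max E hE₁
  suffices h : ∃ N, ∀ (K : Str.{u, v} L), K.Models T → ∀ x : Fin 2 → K.carrier s,
      δ ≤ dist (x 0) (x 1) → ε / 4 ≤ (D N).eval K x by
    obtain ⟨N, hN⟩ := h
    exact ⟨D N, hD₁ N, fun K x hx => hD₂ N K x fun j => hE₂ j K x hx, hN⟩
  by_contra! hcon
  choose K hK x hx hlt using hcon
  -- The counterexample for the maximum of `E 0, …, E n` is the `n`-th factor.
  let U : Ultrafilter ℕ := hyperfilter ℕ
  let X : Fin 2 → (ultraproduct K U).carrier s := fun e => umk ⟨fun n => x n e⟩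
  have hXd : δ ≤ dist (X 0) (X 1) := by
    refine le_trans ?_ (dist_umk _ _).ge
    exact ge_of_tendsto' (PreUltra.tendsto_dist _ _) hx
  have hEX : ∀ j, (E j).eval (ultraproduct K U) X ≤ ε / 4 := by
    intro j
    refine le_of_tendsto ((E j).tendsto_eval_ultraproduct (U := U) fun e => ⟨fun n => x n e⟩) ?_
    filter_upwards [Nat.hyperfilter_le_atTop (eventually_ge_atTop j)] with n hn
    exact (hD₃ n (K n) (x n) j hn).trans (hlt n).le
  have hmod : (ultraproduct K U).Models T := models_ultraproduct hK
  have : X 0 = X 1 := by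
    refine hF.eq_of_forall hε (half_lt_self hε) hΔ hmod fun θ hθ y => ?_
    refine abs_sub_le_of_dense hφ hmod (half_pos hε).le (fun i w y z₀ z₁ hw h₀ h₁ => ?_) θ hθ y
    obtain ⟨j, hj⟩ := hE₃ i w hw
    have := hj (ultraproduct K U) X y z₀ z₁ h₀ h₁
    linarith [hEX j]
  rw [this, dist_self] at hXd
  exact hXd.not_gt hδ

/-! ### Plays controlling all formulas up to small errors -/

/-- If `Ω` is shift increasing, a formula respecting `Ω` at position `j` is controlled along every
increasing sequence of positions from `j` on. -/
theorem IsDistortionSystem.gap_le_of_strictMono {T : Theory L} {Δ : FormulaSet L}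
    (hΔ : IsDistortionSystem.{u, v} T Δ) {Ω : WeakModulus} (hΩ : Ω.ShiftIncreasing)
    {M N : Str.{u, v} L} (hM : M.Models T) (hN : N.Models T) {p : ℕ → SProd M N} {t : ℝ≥0∞}
    (hp : ∀ n, backForthInfty Δ Ω (fun i : Fin n => p i) ≤ t) {k : ℕ} {Γ : Fin k → L.Sorts}
    (φ : Formula L Γ) (hφ : φ ∈ Δ Γ) {j : ℕ}
    (hj : ∀ K : Str.{u, v} L, K.Models T → φ.RespectsAt Ω j K) {W : Fin k → ℕ}
    (hW : StrictMono W) (hjW : ∀ i, j ≤ W i) (m : ∀ i, M.carrier (Γ i)) (n : ∀ i, N.carrier (Γ i))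
    (hmn : ∀ i, p (W i) = ⟨Γ i, m i, n i⟩) : gap (pairs m n) φ ≤ t := by
  obtain rfl : Γ = fun i => (p (W i)).1 := funext fun i => by rw [hmn]
  obtain rfl : m = fun i => (p (W i)).2.1 := by
    funext i
    exact (congrArg Prod.fst (eq_of_heq (Sigma.mk.inj (hmn i)).2)).symm
  obtain rfl : n = fun i => (p (W i)).2.2 := by
    funext i
    exact (congrArg Prod.snd (eq_of_heq (Sigma.mk.inj (hmn i)).2)).symm
  let l := Finset.univ.sup W + 1
  have hl : ∀ i, W i < l := fun i => Nat.lt_succ_of_le (Finset.le_sup (Finset.mem_univ i))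
  let W' : Fin k → Fin l := fun i => ⟨W i, hl i⟩
  have h := gap_rename (fun i : Fin l => p i) W' φ
  change _ = gap (pairs _ _) φ at h
  rw [← h]
  refine (hΔ.gap_le Ω hM hN _ _ (hΔ.rename_mem _ _ φ hφ) fun K hK a b => ?_).trans (hp l)
  rw [φ.eval_rename K W' _ a (fun i => a (W' i)) fun _ => HEq.rfl,
    φ.eval_rename K W' _ b (fun i => b (W' i)) fun _ => HEq.rfl]
  refine (hj K hK _ _).trans ?_
  -- `σ` sends the positions `j, …, j + k - 1` of the variables of `φ` to `W 0, …, W (k - 1)`.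
  let σ : ℕ → ℕ := fun x => if x < j then x else if h : x - j < k then W ⟨x - j, h⟩ else l + x
  have hσ : StrictMono σ := by
    intro x y hxy
    simp only [σ]
    by_cases hx : x < j
    · rw [if_pos hx]
      by_cases hy : y < j
      · rwa [if_pos hy]
      · rw [if_neg hy]
        split_ifs with h
        · exact hx.trans_le (hjW _)
        · omega
    · rw [if_neg hx, if_neg (by omega : ¬ y < j)]
      by_cases hy : y - j < k
      · rw [dif_pos (by omega : x - j < k), dif_pos hy]
        exact hW (by simp only [Fin.mk_lt_mk]; omega)
      · rw [dif_neg hy]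
        split_ifs with h
        · exact (hl _).trans_le (Nat.le_add_right _ _)
        · omega
  refine le_trans (Ω.mono fun x => ?_) (hΩ (place 0 fun i => nndist (a i) (b i)) σ hσ)
  rcases place_cases (k := k) j x with ⟨i, rfl⟩ | hx
  · rw [place_add_apply]
    have : σ (j + i) = W' i := by
      simp only [σ, W']
      rw [if_neg (by omega), dif_pos (by simp)]
      simp
    rw [Function.comp_apply, this, place_zero_apply]
  · rw [place_eq_zero _ hx]
    exact zero_le

/-- The sequence `p` of pairs controls the formulas of `Δ` up to `τ`: if each variable of a formula
is allowed an infinite set of positions, then some choice of positions gives a pair of tuples at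
which the formula differs by little more than `τ`. The order of the positions cannot be prescribed,
as a modulus may depend on the order of its arguments. -/
def Controls (Δ : FormulaSet L) {M N : Str.{u, v} L} (p : ℕ → SProd M N) (τ : ℝ) : Prop :=
  ∀ (n : ℕ) (Γ : Fin n → L.Sorts), ∀ ψ ∈ Δ Γ, ∀ η : ℝ, 0 < η → ∀ S : Fin n → Set ℕ,
    (∀ i, ∃ᶠ x in atTop, x ∈ S i) → (∀ i, ∀ x ∈ S i, (p x).1 = Γ i) →
    ∃ w : Fin n → ℕ, (∀ i, w i ∈ S i) ∧ ∀ (a : ∀ i, M.carrier (Γ i)) (b : ∀ i, N.carrier (Γ i)),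
      (∀ i, p (w i) = ⟨Γ i, a i, b i⟩) → |ψ.eval M a - ψ.eval N b| ≤ τ + η

theorem exists_strictMono_mem {k : ℕ} (S : Fin k → Set ℕ) (hS : ∀ i, ∃ᶠ x in atTop, x ∈ S i)
    (j : ℕ) : ∃ W : Fin k → ℕ, StrictMono W ∧ (∀ i, W i ∈ S i) ∧ ∀ i, j ≤ W i := by
  have h : ∀ n, ∃ᶠ x in atTop, j ≤ x ∧ ∀ h : n < k, x ∈ S ⟨n, h⟩ := by
    intro n
    by_cases hn : n < k
    · refine ((hS ⟨n, hn⟩).and_eventually (eventually_ge_atTop j)).mono fun x hx => ?_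
      exact ⟨hx.2, fun _ => hx.1⟩
    · exact (eventually_ge_atTop j).frequently.mono fun x hx => ⟨hx, fun h => absurd h hn⟩
  obtain ⟨W, hW, hW'⟩ := extraction_forall_of_frequently h
  exact ⟨fun i => W i, fun a b hab => hW hab, fun i => (hW' i).2 i.2, fun i => (hW' i).1⟩

/-- Plays control all formulas of `Δ`: the positions are chosen increasing in the order of the
variables of a member of the dense sequence approximating the given formula. -/
theorem IsDistortionSystem.controls {T : Theory L} {Δ : FormulaSet L}
    (hΔ : IsDistortionSystem.{u, v} T Δ) {Ω : WeakModulus} (hΩ : Ω.ShiftIncreasing)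
    {φ : ℕ → Σ (n : ℕ) (Γ : Fin n → L.Sorts), Formula L Γ} (hφ : IsDenseSeq.{u, v} T Δ φ)
    (hφΩ : ∀ i, ∃ j : ℕ, ∀ K : Str.{u, v} L, K.Models T → (φ i).2.2.RespectsAt Ω j K)
    {M N : Str.{u, v} L} (hM : M.Models T) (hN : N.Models T) {p : ℕ → SProd M N} {τ : ℝ}
    (hτ : 0 ≤ τ) (hp : ∀ n, backForthInfty Δ Ω (fun i : Fin n => p i) ≤ ENNReal.ofReal τ)
    (hs : ∀ s, ∃ᶠ x in atTop, (p x).1 = s) : Controls Δ p τ := by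
  classical
  intro n Γ ψ hψ η hη S hS hSs
  obtain ⟨i, l, Θ, f, hf, g, hg, hfi, hgi, hw⟩ := hφ.2 _ _ ψ hψ (η / 2) (half_pos hη)
  obtain ⟨j, hj⟩ := hφΩ i
  -- Variables of `Θ` that do not occur in `ψ` may take any position carrying their sort.
  let S' : Fin l → Set ℕ := fun c => {x | (p x).1 = Θ c ∧ ∀ i, g i = c → x ∈ S i}
  have hS' : ∀ c, ∃ᶠ x in atTop, x ∈ S' c := by
    intro c
    by_cases hc : ∃ i, g i = c
    · obtain ⟨i, rfl⟩ := hc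
      refine (hS i).mono fun x hx => ⟨(hSs i x hx).trans (hg i).symm, fun i' hi' => ?_⟩
      rwa [hgi hi']
    · exact (hs (Θ c)).mono fun x hx => ⟨hx, fun i hi => absurd ⟨i, hi⟩ hc⟩
  obtain ⟨W, hWm, hWS, hWj⟩ := exists_strictMono_mem (fun i' => S' (f i')) (fun _ => hS' _) j
  have key : ∀ c, ∃ x ∈ S' c, ∀ i', f i' = c → x = W i' := by
    intro c
    by_cases hc : ∃ i', f i' = c
    · obtain ⟨i', rfl⟩ := hc
      exact ⟨W i', hWS i', fun i'' h => by rw [hfi h]⟩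
    · obtain ⟨x, hx⟩ := (hS' c).exists
      exact ⟨x, hx, fun i' h => absurd ⟨i', h⟩ hc⟩
  choose w hwS hwW using key
  have hex : ∀ c, ∃ (x : M.carrier (Θ c)) (y : N.carrier (Θ c)), p (w c) = ⟨Θ c, x, y⟩ := by
    intro c
    have h := (hwS c).1
    rcases hpc : p (w c) with ⟨s, x, y⟩
    rw [hpc] at h
    dsimp only at h
    subst h
    exact ⟨x, y, rfl⟩
  choose A B hAB using hex
  refine ⟨fun i => w (g i), fun i => (hwS _).2 i rfl, fun a b hab => ?_⟩
  have hpair : ∀ {s s' : L.Sorts} {x : M.carrier s} {y : N.carrier s} {x' : M.carrier s'}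
      {y' : N.carrier s'}, (⟨s, x, y⟩ : SProd M N) = ⟨s', x', y'⟩ → x ≍ x' ∧ y ≍ y' := by
    intro s s' x y x' y' h
    cases h
    exact ⟨HEq.rfl, HEq.rfl⟩
  have h1 := hw M hM A
  have h2 := hw N hN B
  rw [ψ.eval_rename M g hg A a fun i => (hpair ((hab i).symm.trans (hAB _))).1] at h1
  rw [ψ.eval_rename N g hg B b fun i => (hpair ((hab i).symm.trans (hAB _))).2] at h2
  let A' : ∀ i', M.carrier ((φ i).2.1 i') := fun i' => cast (congrArg M.carrier (hf i')) (A (f i'))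
  let B' : ∀ i', N.carrier ((φ i).2.1 i') := fun i' => cast (congrArg N.carrier (hf i')) (B (f i'))
  have hA' : ∀ i', A' i' ≍ A (f i') := fun i' => cast_heq _ _
  have hB' : ∀ i', B' i' ≍ B (f i') := fun i' => cast_heq _ _
  rw [(φ i).2.2.eval_rename M f hf A A' hA'] at h1
  rw [(φ i).2.2.eval_rename N f hf B B' hB'] at h2
  have h3 := hΔ.gap_le_of_strictMono hΩ hM hN hp (φ i).2.2 (hφ.1 i) hj hWm hWj A' B' fun i' => by
    have hmk : ∀ {s s' : L.Sorts} (_ : s = s') {x : M.carrier s} {y : N.carrier s}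
        {x' : M.carrier s'} {y' : N.carrier s'}, x' ≍ x → y' ≍ y →
        (⟨s, x, y⟩ : SProd M N) = ⟨s', x', y'⟩ := by
      rintro s _ rfl x y _ _ ⟨⟩ ⟨⟩
      rfl
    rw [← hwW (f i') i' rfl, hAB]
    exact hmk (hf i') (hA' i') (hB' i')
  have h4 : |(φ i).2.2.eval M A' - (φ i).2.2.eval N B'| ≤ τ :=
    (ENNReal.ofReal_le_ofReal_iff hτ).1 h3
  have e1 := abs_le.1 h1
  have e2 := abs_le.1 h2
  have e3 := abs_le.1 h4
  exact abs_le.2 ⟨by linarith [e1.1, e1.2, e2.1, e2.2, e3.1], by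
    linarith [e1.1, e1.2, e2.1, e2.2, e3.2]⟩

theorem Controls.swap {Δ : FormulaSet L} {M N : Str.{u, v} L} {p : ℕ → SProd M N} {τ : ℝ}
    (h : Controls Δ p τ) : Controls Δ (fun x => swapPair (p x)) τ := by
  intro n Γ ψ hψ η hη S hS hSs
  obtain ⟨w, hw, h⟩ := h n Γ ψ hψ η hη S hS hSs
  refine ⟨w, hw, fun a b hab => ?_⟩
  rw [abs_sub_comm]
  exact h b a fun i => congrArg swapPair (hab i)

/-! ### The cluster set of a play -/

/-- The pairs to which subsequences of `p` converge. -/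
def clusterSet {M N : Str.{u, v} L} (p : ℕ → SProd M N) : Set (SProd M N) :=
  {q | ∀ δ : ℝ, 0 < δ → ∃ᶠ i in atTop, ∃ x y, p i = ⟨q.1, x, y⟩ ∧ dist q.2.1 x < δ ∧
    dist q.2.2 y < δ}

theorem Controls.dis_clusterSet_le {Δ : FormulaSet L} {M N : Str.{u, v} L}
    {p : ℕ → SProd M N} {τ : ℝ} (h : Controls Δ p τ) :
    dis Δ (clusterSet p) ≤ ENNReal.ofReal τ := by
  refine dis_le Δ fun n q hq ψ hψ => ENNReal.ofReal_le_ofReal ?_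
  refine le_of_forall_pos_le_add fun ε hε => ?_
  have hcM := Metric.continuous_iff.1 (ψ.uniformContinuous_eval M).continuous
    (fun i => (q i).2.1) (ε / 3) (by linarith)
  have hcN := Metric.continuous_iff.1 (ψ.uniformContinuous_eval N).continuous
    (fun i => (q i).2.2) (ε / 3) (by linarith)
  obtain ⟨δ₁, hδ₁, h₁⟩ := hcM
  obtain ⟨δ₂, hδ₂, h₂⟩ := hcN
  have hδ := lt_min hδ₁ hδ₂
  obtain ⟨w, hw, hψ'⟩ := h _ _ ψ hψ (ε / 3) (by linarith) _ (fun i => hq i _ hδ) (by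
    rintro i x ⟨a, b, e, -⟩
    rw [e])
  choose a b hab ha hb using hw
  have e1 := h₁ a ((dist_pi_lt_iff hδ₁).2 fun i => by
    rw [dist_comm]; exact (ha i).trans_le (min_le_left _ _))
  have e2 := h₂ b ((dist_pi_lt_iff hδ₂).2 fun i => by
    rw [dist_comm]; exact (hb i).trans_le (min_le_right _ _))
  have e3 := abs_le.1 (hψ' a b hab)
  rw [Real.dist_eq] at e1 e2
  have e1 := abs_lt.1 e1
  have e2 := abs_lt.1 e2
  exact abs_le.2 ⟨by linarith [e1.1, e1.2, e2.1, e2.2, e3.1], by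
    linarith [e1.1, e1.2, e2.1, e2.2, e3.2]⟩

/-- If `x n → a` along a subsequence of a controlling sequence, then the partners `y n` of `x n`
have a limit point: an infinite `δ`-separated set of partners, split into two infinite halves,
would contradict the control of a formula separating points at distance `δ`. -/
theorem Controls.totallyBounded {Δ : FormulaSet L} {M N : Str.{u, v} L} {p : ℕ → SProd M N}
    {τ c : ℝ} (h : Controls Δ p τ) (hc : τ < c) {s : L.Sorts}
    (hsep : ∀ δ : ℝ, 0 < δ → ∃ D ∈ Δ (fun _ : Fin 2 => s),
      (∀ x : Fin 2 → M.carrier s, x 0 = x 1 → D.eval M x = 0) ∧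
      ∀ x : Fin 2 → N.carrier s, δ ≤ dist (x 0) (x 1) → c ≤ D.eval N x)
    {ι : ℕ → ℕ} (hι : StrictMono ι) {x : ℕ → M.carrier s} {y : ℕ → N.carrier s}
    (hp : ∀ n, p (ι n) = ⟨s, x n, y n⟩) {a : M.carrier s} (hx : Tendsto x atTop (𝓝 a)) :
    TotallyBounded (Set.range y) := by
  by_contra hcon
  rw [Metric.totallyBounded_iff] at hcon
  push Not at hcon
  obtain ⟨δ, hδ, hcon⟩ := hcon
  obtain ⟨f, -, hf⟩ := exists_seq_of_forall_finset_exists (fun _ : ℕ => True)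
    (fun i j => δ ≤ dist (y i) (y j)) fun t _ => by
      by_contra! hno
      refine hcon (y '' t) (t.finite_toSet.image y) ?_
      rintro _ ⟨j, rfl⟩
      obtain ⟨i, hi, hij⟩ := hno j trivial
      rw [dist_comm] at hij
      exact Set.mem_biUnion ⟨i, hi, rfl⟩ hij
  have hfi : Function.Injective f := by
    intro i j hij
    by_contra hne
    rcases lt_or_gt_of_ne hne with hlt | hlt
    · have := hf _ _ hlt
      rw [hij, dist_self] at this
      exact this.not_gt hδ
    · have := hf _ _ hlt
      rw [hij, dist_self] at this
      exact this.not_gt hδ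
  obtain ⟨D, hD, hD₁, hD₂⟩ := hsep δ hδ
  obtain ⟨r, hr, hrD⟩ := Metric.continuous_iff.1 (D.uniformContinuous_eval M).continuous
    (fun _ => a) ((c - τ) / 2) (by linarith)
  -- The two halves of the separated sequence.
  let par : Fin 2 → ℕ → ℕ := fun e n => f (2 * n + e)
  have hpar : ∀ e, Tendsto (par e) atTop atTop := fun e =>
    (hfi.comp fun i j hij => by simpa using hij).nat_tendsto_atTop
  let S : Fin 2 → Set ℕ := fun e => {i | ∃ n, i = ι (par e n) ∧ dist (x (par e n)) a < r}
  have hS : ∀ e, ∃ᶠ i in atTop, i ∈ S e := by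
    intro e
    refine (hι.tendsto_atTop.comp (hpar e)).frequently (Eventually.frequently ?_)
    filter_upwards [(hx.comp (hpar e)).eventually (Metric.ball_mem_nhds a hr)] with n hn
    exact ⟨n, rfl, hn⟩
  obtain ⟨w, hw, hDw⟩ := h _ _ D hD ((c - τ) / 3) (by linarith) S hS (by
    rintro e i ⟨n, rfl, -⟩
    rw [hp])
  choose n hn hxn using hw
  have h1 := hDw (fun e => x (par e (n e))) (fun e => y (par e (n e))) fun e => by
    rw [hn, hp]
  have h2 := hrD (fun e => x (par e (n e))) ((dist_pi_lt_iff hr).2 hxn)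
  rw [hD₁ (fun _ => a) rfl, Real.dist_eq, sub_zero] at h2
  have h3 := hD₂ (fun e => y (par e (n e))) (by
    simp only [par]
    have hne : 2 * n 0 + ((0 : Fin 2) : ℕ) ≠ 2 * n 1 + ((1 : Fin 2) : ℕ) := by
      simp only [Fin.val_zero, Fin.val_one]
      omega
    rcases lt_or_gt_of_ne hne with hlt | hlt
    · exact hf _ _ hlt
    · rw [dist_comm]
      exact hf _ _ hlt)
  have e1 := abs_le.1 h1
  have e2 := abs_lt.1 h2
  linarith [e1.1, e2.2]

theorem Controls.exists_mem_clusterSet {Δ : FormulaSet L} {M N : Str.{u, v} L}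
    {p : ℕ → SProd M N} {τ c : ℝ} (h : Controls Δ p τ) (hc : τ < c) {s : L.Sorts}
    (hsep : ∀ δ : ℝ, 0 < δ → ∃ D ∈ Δ (fun _ : Fin 2 => s),
      (∀ x : Fin 2 → M.carrier s, x 0 = x 1 → D.eval M x = 0) ∧
      ∀ x : Fin 2 → N.carrier s, δ ≤ dist (x 0) (x 1) → c ≤ D.eval N x) (a : M.carrier s)
    (ha : ∀ r : ℝ, 0 < r → ∃ᶠ i in atTop, ∃ x y, p i = ⟨s, x, y⟩ ∧ dist a x < r) :
    ∃ b, (⟨s, a, b⟩ : SProd M N) ∈ clusterSet p := by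
  obtain ⟨ι, hι, hp⟩ := extraction_forall_of_frequently
    fun n : ℕ => ha (1 / ((n : ℝ) + 1)) (by positivity)
  choose x y hxy hx using hp
  have hxa : Tendsto x atTop (𝓝 a) := by
    rw [tendsto_iff_dist_tendsto_zero]
    refine squeeze_zero (fun _ => dist_nonneg) (fun n => ?_) tendsto_one_div_add_atTop_nhds_zero_nat
    rw [dist_comm]
    exact (hx n).le
  have htb := h.totallyBounded hc hsep hι hxy hxa
  obtain ⟨b, -, κ, hκ, hb⟩ := (htb.closure.isCompact_of_isClosed
    isClosed_closure).tendsto_subseq fun n => subset_closure ⟨n, rfl⟩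
  refine ⟨b, fun δ hδ => ?_⟩
  refine (hι.tendsto_atTop.comp hκ.tendsto_atTop).frequently (Eventually.frequently ?_)
  filter_upwards [(hxa.comp hκ.tendsto_atTop).eventually (Metric.ball_mem_nhds a hδ),
    hb.eventually (Metric.ball_mem_nhds b hδ)] with n h1 h2
  refine ⟨_, _, hxy _, ?_, ?_⟩
  · rw [dist_comm]; exact h1
  · rw [dist_comm]; exact h2

theorem Controls.isCorrelation_clusterSet {Δ : FormulaSet L} {M N : Str.{u, v} L}
    {p : ℕ → SProd M N} {τ c : ℝ} (h : Controls Δ p τ) (hc : τ < c)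
    (hsep : ∀ (s : L.Sorts) (δ : ℝ), 0 < δ → ∃ D ∈ Δ (fun _ : Fin 2 => s),
      ∀ K : Str.{u, v} L, K = M ∨ K = N →
        (∀ x : Fin 2 → K.carrier s, x 0 = x 1 → D.eval K x = 0) ∧
        ∀ x : Fin 2 → K.carrier s, δ ≤ dist (x 0) (x 1) → c ≤ D.eval K x)
    (hM : ∀ s (a : M.carrier s) (r : ℝ), 0 < r →
      ∃ᶠ i in atTop, ∃ x y, p i = ⟨s, x, y⟩ ∧ dist a x < r)
    (hN : ∀ s (b : N.carrier s) (r : ℝ), 0 < r →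
      ∃ᶠ i in atTop, ∃ x y, p i = ⟨s, x, y⟩ ∧ dist b y < r) :
    IsCorrelation (clusterSet p) := by
  refine ⟨fun _ _ => ⟨trivial, trivial⟩, fun s a _ => ?_, fun s b _ => ?_⟩
  · refine h.exists_mem_clusterSet hc (fun δ hδ => ?_) a (hM s a)
    obtain ⟨D, hD, hK⟩ := hsep s δ hδ
    exact ⟨D, hD, (hK M (.inl rfl)).1, (hK N (.inr rfl)).2⟩
  · obtain ⟨a, ha⟩ := h.swap.exists_mem_clusterSet hc (fun δ hδ => by
      obtain ⟨D, hD, hK⟩ := hsep s δ hδ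
      exact ⟨D, hD, (hK N (.inr rfl)).1, (hK M (.inl rfl)).2⟩) b fun r hr =>
        (hN s b r hr).mono fun i ⟨x, y, e, hd⟩ => ⟨y, x, congrArg swapPair e, hd⟩
    exact ⟨a, fun δ hδ => (ha δ hδ).mono fun i ⟨y, x, e, h1, h2⟩ =>
      ⟨x, y, congrArg swapPair e, h2, h1⟩⟩

/-- In the functional case, the cluster set of a play is a correlation realizing `r_∞` as soon as
`r_∞` is small. -/
theorem FunctionalBelow.rho_le_backForthInfty (hL : L.IsCountable) {T : Theory L}
    {Δ : FormulaSet L} (hΔ : IsDistortionSystem.{u, v} T Δ) {ε : ℝ} (hε : 0 < ε)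
    (hF : FunctionalBelow.{u, v} T Δ ε) {Ω : WeakModulus} (hΩ : Ω.ShiftIncreasing)
    {φ : ℕ → Σ (n : ℕ) (Γ : Fin n → L.Sorts), Formula L Γ} (hφ : IsDenseSeq.{u, v} T Δ φ)
    (hφΩ : ∀ i, ∃ j : ℕ, ∀ K : Str.{u, v} L, K.Models T → (φ i).2.2.RespectsAt Ω j K)
    {M N : Str.{u, v} L} (hM : M.Models T) (hN : N.Models T) (hMs : M.IsSeparable)
    (hNs : N.IsSeparable) (p₀ : Fin 0 → SProd M N)
    (hp₀ : backForthInfty Δ Ω p₀ < ENNReal.ofReal (ε / 8)) :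
    rho Δ p₀ ≤ backForthInfty Δ Ω p₀ := by
  rcases isEmpty_or_nonempty L.Sorts with hS | hS
  · exact rho_le_of_isEmpty Δ Ω _
  refine le_of_forall_gt_imp_ge_of_dense fun t ht => ?_
  obtain ⟨τ, hτ0, hτε, hτt, hτ⟩ : ∃ τ : ℝ, 0 ≤ τ ∧ τ ≤ ε / 8 ∧ ENNReal.ofReal τ ≤ t ∧
      backForthInfty Δ Ω p₀ < ENNReal.ofReal τ := by
    have hfin : min t (ENNReal.ofReal (ε / 8)) ≠ ∞ :=
      ne_top_of_le_ne_top ENNReal.ofReal_ne_top (min_le_right _ _)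
    refine ⟨(min t (ENNReal.ofReal (ε / 8))).toReal, ENNReal.toReal_nonneg, ?_, ?_, ?_⟩
    · refine (ENNReal.toReal_mono ENNReal.ofReal_ne_top (min_le_right _ _)).trans ?_
      rw [ENNReal.toReal_ofReal (by linarith)]
    · rw [ENNReal.ofReal_toReal hfin]
      exact min_le_left _ _
    · rw [ENNReal.ofReal_toReal hfin]
      exact lt_min ht hp₀
  obtain ⟨A, hA, hAc, -⟩ := exists_countable_isDenseSub hL hMs (Γ := emptyCtx L) fun i => i.elim0
  obtain ⟨B, hB, hBc, -⟩ := exists_countable_isDenseSub hL hNs (Γ := emptyCtx L) fun i => i.elim0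
  obtain ⟨p, -, hp, -, hA', hB'⟩ := hΔ.exists_play Ω hA.1 hB.1 hAc hBc p₀ (fun i => i.elim0) hτ
  have hMf : ∀ s (a : M.carrier s) (r : ℝ), 0 < r →
      ∃ᶠ i in atTop, ∃ x y, p i = ⟨s, x, y⟩ ∧ dist a x < r := by
    intro s a r hr
    obtain ⟨x, hx, hd⟩ := (hA.1 s).exists_dist_lt a hr
    refine frequently_atTop.2 fun n => ?_
    obtain ⟨i, hi, y, e⟩ := hA' s x hx n
    exact ⟨i, hi, x, y, e, hd⟩
  have hNf : ∀ s (b : N.carrier s) (r : ℝ), 0 < r →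
      ∃ᶠ i in atTop, ∃ x y, p i = ⟨s, x, y⟩ ∧ dist b y < r := by
    intro s b r hr
    obtain ⟨y, hy, hd⟩ := (hB.1 s).exists_dist_lt b hr
    refine frequently_atTop.2 fun n => ?_
    obtain ⟨i, hi, x, e⟩ := hB' s y hy n
    exact ⟨i, hi, x, y, e, hd⟩
  have hctrl : Controls Δ p τ := by
    refine hΔ.controls hΩ hφ hφΩ hM hN hτ0 (fun n => (hp n (Nat.zero_le n)).le) fun s => ?_
    refine (hMf s (M.nonempty s).some 1 one_pos).mono ?_
    rintro i ⟨x, y, e, -⟩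
    rw [e]
  -- The separating formulas are at least `ε / 4` on separated pairs, and `τ ≤ ε / 8`.
  have hcorr : IsCorrelation (clusterSet p) := by
    refine hctrl.isCorrelation_clusterSet (c := ε / 4) (by linarith) (fun s δ hδ => ?_) hMf hNf
    obtain ⟨D, hD, hD₁, hD₂⟩ := hF.exists_separating hε hΔ hφ s hδ
    refine ⟨D, hD, ?_⟩
    rintro K (rfl | rfl)
    exacts [⟨hD₁ _, hD₂ _ hM⟩, ⟨hD₁ _, hD₂ _ hN⟩]
  exact (iInf₂_le_of_le _ hcorr (iInf_le_of_le (fun i => i.elim0) le_rfl)).trans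
    (hctrl.dis_clusterSet_le.trans hτt)

end MetricLogic

end

theorem mainTheorem2 (L : MetricLogic.Lang.{u}) (hL : L.IsCountable)
    (T : MetricLogic.Theory L) (Δ : MetricLogic.FormulaSet L)
    (hΔ : MetricLogic.IsDistortionSystem.{u, v} T Δ) (Ω : MetricLogic.WeakModulus) :
    -- (i)
    ((∀ M N : MetricLogic.Str.{u, v} L, M.Models T → N.Models T →
        ∀ (k : ℕ) (Γ : Fin k → L.Sorts) (m : ∀ i, M.carrier (Γ i)) (n : ∀ i, N.carrier (Γ i)),
          MetricLogic.backForthInfty Δ Ω (MetricLogic.pairs m n) ≤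
            MetricLogic.almostRho Δ (MetricLogic.pairs m n)) ∧
      -- `r_∞` is `2`-Lipschitz in `ρ_Δ`
      (∀ M N M' N' : MetricLogic.Str.{u, v} L,
        M.Models T → N.Models T → M'.Models T → N'.Models T →
        ∀ (k : ℕ) (Γ : Fin k → L.Sorts) (m : ∀ i, M.carrier (Γ i)) (n : ∀ i, N.carrier (Γ i))
          (m' : ∀ i, M'.carrier (Γ i)) (n' : ∀ i, N'.carrier (Γ i)),
          MetricLogic.backForthInfty Δ Ω (MetricLogic.pairs m n) ≤
            MetricLogic.backForthInfty Δ Ω (MetricLogic.pairs m' n') +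
              2 * max (MetricLogic.rho Δ (MetricLogic.pairs m m'))
                (MetricLogic.rho Δ (MetricLogic.pairs n n')))) ∧
    -- (ii)
    (MetricLogic.IsUUC.{u, v} T Δ → Ω.ShiftIncreasing →
      (∀ (k : ℕ) (Γ : Fin k → L.Sorts), ∀ φ ∈ Δ Γ,
        ∀ K : MetricLogic.Str.{u, v} L, K.Models T → φ.RespectsAt Ω 0 K) →
      ∀ M N : MetricLogic.Str.{u, v} L, M.Models T → N.Models T → M.IsSeparable → N.IsSeparable →
        ∀ (k : ℕ) (Γ : Fin k → L.Sorts) (m : ∀ i, M.carrier (Γ i)) (n : ∀ i, N.carrier (Γ i)),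
          MetricLogic.backForthInfty Δ Ω (MetricLogic.pairs m n) =
            MetricLogic.rho Δ (MetricLogic.pairs m n)) ∧
    -- (iii)
    (MetricLogic.IsFunctional.{u, v} T Δ →
      ∀ φ : ℕ → Σ (n : ℕ) (Γ : Fin n → L.Sorts), MetricLogic.Formula L Γ,
        MetricLogic.IsDenseSeq.{u, v} T Δ φ → Ω.ShiftIncreasing →
        (∀ i, ∃ j : ℕ, ∀ K : MetricLogic.Str.{u, v} L, K.Models T →
          (φ i).2.2.RespectsAt Ω j K) →
        ∃ ε : ℝ, 0 < ε ∧ ∀ M N : MetricLogic.Str.{u, v} L,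
          M.Models T → N.Models T → M.IsSeparable → N.IsSeparable →
          ∀ p : Fin 0 → MetricLogic.SProd M N,
            MetricLogic.backForthInfty Δ Ω p < ENNReal.ofReal ε →
              MetricLogic.backForthInfty Δ Ω p = MetricLogic.rho Δ p) := by
  refine ⟨⟨fun M N _ _ k Γ m n => MetricLogic.backForthInfty_le_almostRho Δ Ω _,
    fun M N M' N' _ _ _ _ k Γ m n m' n' => MetricLogic.backForthInfty_le_add_rho Δ Ω m n m' n'⟩,
    fun hU _ hΩ M N hM hN hMs hNs k Γ m n => ?_, fun hF φ hφ hΩ hφΩ => ?_⟩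
  · exact le_antisymm (MetricLogic.backForthInfty_le_rho Δ Ω _)
      (hU.rho_le_backForthInfty hL hΔ hΩ hM hN hMs hNs m n)
  · obtain ⟨ε, hε, hF⟩ := hF
    have hF : MetricLogic.FunctionalBelow.{u, v} T Δ ε := hF
    refine ⟨ε / 8, by positivity, fun M N hM hN hMs hNs p hp => ?_⟩
    exact le_antisymm (MetricLogic.backForthInfty_le_rho Δ Ω p)
      (hF.rho_le_backForthInfty hL hΔ hε hΩ hφ hφΩ hM hN hMs hNs p hp)
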